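/- Let $p\in\mathbb N$, and let $h$ be a probability density on $\mathbb R^p$ that vanishes outside $[0,1]^p$ and satisfies $C_0^{-1}\le h(\mathbf x)\le C_0$ for all $\mathbf x\in[0,1]^p$, for some constant $C_0>0$. Let $\alpha_0\in\mathbb R$, $\pi_0\in(0,1)$ and $u_1,\dots,u_p$ be such that, with $\eta_0(\mathbf x)=\sum_{j=1}^p u_j(x_j)$, the function $g(\mathbf x)=\exp\{\alpha_0+\eta_0(\mathbf x)\}h(\mathbf x)$ is a probability density. Assume: (1) $|\alpha_0|\le M$ and $\pi_0\in[\underline\pi,1-\underline\pi]$, for known constants $M$ and $\underline\pi\in(0,1/2)$. (2) For fixed integers $m\ge 2$ and $0<k\le m$ and for all $j$, $u_j\in C^k([0,1])$ and $\int_0^1u_j(x)\,dx=0$. Moreover, for at least two distinct indices $j$ the function $u_j$ is not constant on $[0,1]$ (so that the model is identifiable), and $\sup_{[0,1]}|u_j|\le q_j$ for every $j$, for known constants $q_1,\dots,q_p$. For sample sizes $n=n_0+n_1\to\infty$ with constant ratio $\rho=n_0/n_1\in(0,\infty)$, let $\mathbf x_1,\dots,\mathbf x_n$ be independent, where $\mathbf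 x_1,\dots,\mathbf x_{n_0}$ have density $g$ and $\mathbf x_{n_0+1},\dots,\mathbf x_n$ have density $\pi_0g+(1-\pi_0)h$. For each $n$ let $0=\xi_0<\xi_1<\dots<\xi_{K_n}<\xi_{K_n+1}=1$ be a (possibly $n$-dependent) partition with $K_n$ interior knots, and let $N^{[m]}_1,\dots,N^{[m]}_{K_n+m}$ be the normalized B-splines of order $m$ for these knots, with the end points $0$ and $1$ repeated $m$ times. Assume: (3) $K_n\to\infty$, $K_n^{1/2}\log K_n=o(\sqrt n)$, and $\max_{0\le i\le K_n}(\xi_{i+1}-\xi_i)\to0$ as $n\to\infty$. Let $\mathcal F_n$ be the set of all $(\pi,\alpha,\nu_1,\dots,\nu_p)$ with $\pi\in[\underline\pi,1-\underline\pi]$, $|\alpha|\le M$ and, for every $j$, $\nu_j=\sum_{k=1}^{K_n+m}\theta_{jk}N_k^{[m]}$ on $[0,1]$ with $\max_k|\theta_{jk}|\le q_j$ and $\int_0^1\nu_j(x)\,dx=0$. Let $(\widehat\pi_n,\widehat\alpha_n,\widehat u_{1,n},\dots,\widehat u_{p,n})$ be a maximizer over $\mathcal F_n$ of the profile empirical log-likelihood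 $$\ell_n(\pi,\alpha,\nu_1,\dots,\nu_p)=\sum_{i=1}^{n_0}\log\frac{n_0e^{\alpha+\eta(\mathbf x_i)-\tau}}{n_1\pi+(n_0+n_1\pi)e^{\alpha+\eta(\mathbf x_i)-\tau}}+\sum_{i=n_0+1}^{n}\log\frac{n_1\pi+n_1\pi e^{\alpha+\eta(\mathbf x_i)-\tau}}{n_1\pi+(n_0+n_1\pi)e^{\alpha+\eta(\mathbf x_i)-\tau}},$$ where $\tau=\log\{(1-\pi)/\pi\}$ and $\eta(\mathbf x)=\sum_{j=1}^p\nu_j(x_j)$, and put $\widehat\eta_n(\mathbf x)=\sum_{j=1}^p\widehat u_{j,n}(x_j)$. Then the estimators are consistent: as $n\to\infty$, $\widehat\alpha_n\to\alpha_0$, $\widehat\pi_n\to\pi_0$ and $\|\widehat\eta_n-\eta_0\|_{L_2(\mathbb P)}\to0$ in probability, where $\mathbb P$ is the feature distribution of the pooled data, that is, the distribution with density $\frac{\rho}{1+\rho}\,g+\frac{1}{1+\rho}\{\pi_0g+(1-\pi_0)h\}$. -/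

import Mathlib

open MeasureTheory ProbabilityTheory Filter Topology Asymptotics
open scoped ENNReal

noncomputable section

namespace GAET

/-! ### Splines -/

/-- A partition `0 = ξ₀ < ξ₁ < ⋯ < ξ_K < ξ_{K+1} = 1` of `[0,1]` with `K` interior knots. -/
structure Knots (K : ℕ) where
  pt : Fin (K + 2) → ℝ
  strictMono : StrictMono pt
  first : pt 0 = 0
  last : pt (Fin.last (K + 1)) = 1

/-- The mesh (largest gap between neighbouring knots). -/
def Knots.mesh {K : ℕ} (ξ : Knots K) : ℝ :=
  ⨆ j : Fin (K + 1), (ξ.pt j.succ - ξ.pt j.castSucc)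

/-- The extended knot sequence for splines of order `m`: the end points `0` and `1` are
repeated `m` times. With indices starting at `0`, the extended knots are
`t_0 = ⋯ = t_{m-1} = 0`, `t_{m-1+j} = ξ_j` for `1 ≤ j ≤ K`, and `t_i = 1` for `i ≥ m + K`.
(The subtraction is the truncated one of `ℕ`, on purpose.) -/
def Knots.ext {K : ℕ} (ξ : Knots K) (m : ℕ) (i : ℕ) : ℝ :=
  ξ.pt ⟨min (i + 1 - m) (K + 1), by omega⟩

/-- The normalized B-splines of degree `d` (order `d + 1`) for the extended knot sequence `t`,
by the Cox-de Boor recursion, with the usual convention `0/0 = 0`. The degree-zero functions are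
the indicators of `[t_i, t_{i+1})`, except that the last nondegenerate interval contains its
right end point `1`, so that the basis sums to one on the closed interval `[0,1]`. -/
def bspline (t : ℕ → ℝ) : ℕ → ℕ → ℝ → ℝ
  | 0, i, x =>
      open Classical in
      if t i ≤ x ∧ (x < t (i + 1) ∨ (t i < t (i + 1) ∧ t (i + 1) = 1 ∧ x = 1)) then 1 else 0
  | d + 1, i, x =>
      (x - t i) / (t (i + d + 1) - t i) * bspline t d i x
        + (t (i + d + 2) - x) / (t (i + d + 2) - t (i + 1)) * bspline t d (i + 1) x

/-- The B-spline basis `N_k^{[m]}`, `k = 0, …, K + m - 1`, of order `m ≥ 1` on the partition `ξ`. -/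
def Knots.basis {K : ℕ} (ξ : Knots K) (m : ℕ) (k : Fin (K + m)) (x : ℝ) : ℝ :=
  bspline (ξ.ext m) (m - 1) k x

/-! ### The model -/

/-- A parameter `(π, α, u_1, …, u_p)`: the mixture proportion, the normalizing constant
and the additive components. -/
structure Param (p : ℕ) where
  prop : ℝ
  alpha : ℝ
  comp : Fin p → ℝ → ℝ

/-- The additive function `η(x) = ∑ⱼ uⱼ(xⱼ)`. -/
def Param.eta {p : ℕ} (θ : Param p) (x : Fin p → ℝ) : ℝ := ∑ j, θ.comp j (x j)

/-- The density of the positive class, `g = exp(α + η) h`. -/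
def Param.posDensity {p : ℕ} (θ : Param p) (h : (Fin p → ℝ) → ℝ) (x : Fin p → ℝ) : ℝ :=
  Real.exp (θ.alpha + θ.eta x) * h x

/-- The density of the unlabeled sample, `π g + (1 - π) h`. -/
def Param.unlDensity {p : ℕ} (θ : Param p) (h : (Fin p → ℝ) → ℝ) (x : Fin p → ℝ) : ℝ :=
  θ.prop * θ.posDensity h x + (1 - θ.prop) * h x

/-- The measure with Lebesgue density `f`. -/
def law {p : ℕ} (f : (Fin p → ℝ) → ℝ) : Measure (Fin p → ℝ) :=
  volume.withDensity fun x => ENNReal.ofReal (f x)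

/-- The feature distribution of the pooled (labeled and unlabeled) data, when the ratio of the
two sample sizes is `ρ`: a fraction `ρ / (1 + ρ)` of the data has density `g`, the rest has
density `π g + (1 - π) h`. -/
def Param.pooledLaw {p : ℕ} (θ : Param p) (h : (Fin p → ℝ) → ℝ) (ρ : ℝ) :
    Measure (Fin p → ℝ) :=
  law fun x => ρ / (1 + ρ) * θ.posDensity h x + 1 / (1 + ρ) * θ.unlDensity h x

/-! ### The estimator -/

/-- The tilt `exp(α + η(x) - τ)` with `τ = log((1 - π)/π)`. -/
def Param.tilt {p : ℕ} (θ : Param p) (x : Fin p → ℝ) : ℝ :=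
  Real.exp (θ.alpha + θ.eta x - Real.log ((1 - θ.prop) / θ.prop))

/-- The profile empirical log-likelihood of the data `x_1, …, x_n`, `n = n₀ + n₁`, of which the
first `n₀` are labeled and the remaining `n₁` are unlabeled. -/
def profileLogLik {p n₀ n₁ : ℕ} (x : Fin (n₀ + n₁) → Fin p → ℝ) (θ : Param p) : ℝ :=
  (∑ i : Fin n₀,
      Real.log ((n₀ * θ.tilt (x (Fin.castAdd n₁ i))) /
        (n₁ * θ.prop + (n₀ + n₁ * θ.prop) * θ.tilt (x (Fin.castAdd n₁ i))))) +
  ∑ i : Fin n₁,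
      Real.log ((n₁ * θ.prop + n₁ * θ.prop * θ.tilt (x (Fin.natAdd n₀ i))) /
        (n₁ * θ.prop + (n₀ + n₁ * θ.prop) * θ.tilt (x (Fin.natAdd n₀ i))))

/-- The sieve space: `π ∈ [πlow, 1 - πlow]`, `|α| ≤ M`, and each component is on `[0,1]` a
centered spline of order `m` on the partition `ξ` whose B-spline coefficients are bounded
by `qⱼ`. -/
def sieve {p K : ℕ} (m : ℕ) (ξ : Knots K) (πlow M : ℝ) (q : Fin p → ℝ) : Set (Param p) :=
  {θ | θ.prop ∈ Set.Icc πlow (1 - πlow) ∧ |θ.alpha| ≤ M ∧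
    ∀ j, ∃ c : Fin (K + m) → ℝ, (∀ k, |c k| ≤ q j) ∧
      (∀ x ∈ Set.Icc (0 : ℝ) 1, θ.comp j x = ∑ k, c k * ξ.basis m k x) ∧
      ∫ x in (0 : ℝ)..1, θ.comp j x = 0}

/-- `θ` is a sieve estimate for the data `x`: a maximizer of the profile log-likelihood over
the sieve space. -/
def IsSieveEstimate {p K n₀ n₁ : ℕ} (m : ℕ) (ξ : Knots K) (πlow M : ℝ) (q : Fin p → ℝ)
    (x : Fin (n₀ + n₁) → Fin p → ℝ) (θ : Param p) : Prop :=
  θ ∈ sieve m ξ πlow M q ∧ IsMaxOn (profileLogLik x) (sieve m ξ πlow M q) θ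

/-- The data `X_1, …, X_n` are independent, the first `n₀` of them have density `g`, and the
remaining `n₁` have density `π g + (1 - π) h`. -/
def IsPUSample {Ω : Type*} [MeasurableSpace Ω] (μ : Measure Ω) {p n₀ n₁ : ℕ}
    (θ : Param p) (h : (Fin p → ℝ) → ℝ) (X : Fin (n₀ + n₁) → Ω → Fin p → ℝ) : Prop :=
  iIndepFun X μ ∧
  (∀ i : Fin n₀, HasLaw (X (Fin.castAdd n₁ i)) (law (θ.posDensity h)) μ) ∧
  ∀ i : Fin n₁, HasLaw (X (Fin.natAdd n₀ i)) (law (θ.unlDensity h)) μ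

end GAET

end

/-!
Write `V = π + (1 - π) exp(-(α + η))`. Given the features, a pooled observation is labeled with
probability `ρ / (ρ + V)` and unlabeled with probability `V / (ρ + V)`, and the profile
log-likelihood is, up to a constant, the log-likelihood of these labels (`profileLogLik_eq`). So the
estimator is a sieve maximum likelihood estimator in a correctly specified binary model with
bounded odds `V`, and consistency rests on four facts.

* The expected criterion drops by at least a multiple of `∫ (V - V₀)²` when `V` replaces the true
  odds `V₀`: a Kullback-Leibler divergence dominates the squared Hellinger distance
  (`sq_dist_le_risk_gap`).
* The empirical criterion is uniformly close to its expectation. By the partition of unity, a grid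
  of coefficients gives a net of the sieve in the uniform norm with at most `A ^ (2 + p (K + m))`
  elements (`exists_sieve_net`); Hoeffding's inequality and a union bound over the net suffice,
  since `K = o(n)` (`measure_exists_deviation_le`, `tendsto_card_mul_exp`).
* The sieve approximates the true parameter: the Schoenberg spline of a component, shifted to be
  centered and shrunk to restore the bound on its coefficients, converges uniformly as the mesh
  tends to zero (`exists_centered_spline`).
* The odds identify the parameter, with a linear modulus (`exists_identification`). The function
  `V - π` is a product of functions of one coordinate, so `I(φ, ψ) = ∫ (V - π) φ(x_j) ψ(x_l)`
  satisfies `I(1, 1) I(φ, ψ) = I(φ, 1) I(1, ψ)`. For centered `φ`, `ψ` a change of `π` with `V`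
  fixed only affects `I(1, 1)`, and `I(φ, ψ) ≠ 0` when `φ` and `ψ` are the centered `exp(-u_j)` and
  `exp(-u_l)` of two nonconstant components. Hence `V` determines `π`, then `α + η`, and, as `η` is
  centered, also `α` and `η`.
-/

noncomputable section

namespace GAET

/-! ### B-splines: support, partition of unity, approximation -/

theorem bspline_mem_support {t : ℕ → ℝ} (ht : Monotone t) :
    ∀ (d i : ℕ) (x : ℝ), bspline t d i x ≠ 0 → t i ≤ x ∧ x ≤ t (i + d + 1)
  | 0, i, x, h => by
    simp only [bspline] at h
    split_ifs at h with h'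
    · refine ⟨h'.1, ?_⟩
      rcases h'.2 with h2 | ⟨_, h3, h4⟩
      · exact h2.le
      · rw [h4]; exact h3.ge
    · exact absurd rfl h
  | d + 1, i, x, h => by
    have hcase : bspline t d i x ≠ 0 ∨ bspline t d (i + 1) x ≠ 0 := by
      by_contra! hc
      exact h (by simp [bspline, hc.1, hc.2])
    rcases hcase with h1 | h1
    · obtain ⟨h2, h3⟩ := bspline_mem_support ht d i x h1
      exact ⟨h2, h3.trans (ht (by omega))⟩
    · obtain ⟨h2, h3⟩ := bspline_mem_support ht d (i + 1) x h1
      exact ⟨(ht (by omega)).trans h2, h3.trans (ht (by omega))⟩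

theorem bspline_nonneg {t : ℕ → ℝ} (ht : Monotone t) :
    ∀ (d i : ℕ) (x : ℝ), 0 ≤ bspline t d i x
  | 0, i, x => by simp only [bspline]; split_ifs <;> norm_num
  | d + 1, i, x => by
    simp only [bspline]
    refine add_nonneg ?_ ?_
    · by_cases h : bspline t d i x = 0
      · simp [h]
      · have := bspline_mem_support ht d i x h
        exact mul_nonneg (div_nonneg (by linarith) (sub_nonneg.2 (ht (by omega))))
          (bspline_nonneg ht d i x)
    · by_cases h : bspline t d (i + 1) x = 0
      · simp [h]
      · have := bspline_mem_support ht d (i + 1) x h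
        have h2 : t (i + 1 + d + 1) = t (i + d + 2) := by congr 1; omega
        exact mul_nonneg (div_nonneg (by linarith) (sub_nonneg.2 (ht (by omega))))
          (bspline_nonneg ht d (i + 1) x)

/-- With the convention `0/0 = 0`, a B-spline all of whose knots coincide is zero. -/
theorem bspline_eq_zero_of_knots_eq {t : ℕ → ℝ} (ht : Monotone t) (d i : ℕ) (x : ℝ)
    (h : t i = t (i + d + 1)) : bspline t d i x = 0 := by
  cases d with
  | zero =>
    simp only [bspline]
    rw [if_neg]
    rintro ⟨h1, h2 | ⟨h2, -⟩⟩ <;> simp only [Nat.add_zero] at h <;> linarith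
  | succ d =>
    have h1 : t (i + d + 1) = t i := le_antisymm (h ▸ ht (by omega)) (ht (by omega))
    have h2 : t (i + d + 2) = t (i + 1) :=
      le_antisymm ((show t (i + d + 2) = t i from h.symm) ▸ ht (by omega)) (ht (by omega))
    simp [bspline, h1, h2]

@[fun_prop]
theorem measurable_bspline (t : ℕ → ℝ) : ∀ d i : ℕ, Measurable (bspline t d i)
  | 0, i => by
    change Measurable fun x => bspline t 0 i x
    simp only [bspline]
    refine Measurable.ite ?_ measurable_const measurable_const
    refine MeasurableSet.inter measurableSet_Ici (MeasurableSet.union measurableSet_Iio ?_)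
    exact ((MeasurableSet.const (t i < t (i + 1))).inter
      ((MeasurableSet.const (t (i + 1) = 1)).inter (measurableSet_singleton 1)))
  | d + 1, i => by
    have h1 := measurable_bspline t d i
    have h2 := measurable_bspline t d (i + 1)
    change Measurable fun x => bspline t (d + 1) i x
    simp only [bspline]
    fun_prop

/-- Raising the degree by one does not change the sum of the first `n` B-splines, provided the
two B-splines at the boundary of the summation range vanish. -/
theorem sum_bspline_succ {t : ℕ → ℝ} (ht : Monotone t) (d n : ℕ) (x : ℝ)
    (h0 : t 0 = t (d + 1)) (hn : t n = t (n + d + 1)) :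
    ∑ i ∈ Finset.range n, bspline t (d + 1) i x = ∑ i ∈ Finset.range n, bspline t d i x := by
  have key : ∀ i, bspline t (d + 1) i x = bspline t d i x +
      ((t (i + 1 + d + 1) - x) / (t (i + 1 + d + 1) - t (i + 1)) * bspline t d (i + 1) x
        - (t (i + d + 1) - x) / (t (i + d + 1) - t i) * bspline t d i x) := by
    intro i
    have e1 : t (i + d + 2) = t (i + 1 + d + 1) := by congr 1; omega
    have e2 : (x - t i) / (t (i + d + 1) - t i) * bspline t d i x = bspline t d i x
        - (t (i + d + 1) - x) / (t (i + d + 1) - t i) * bspline t d i x := by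
      by_cases h : t i = t (i + d + 1)
      · simp [bspline_eq_zero_of_knots_eq ht d i x h]
      · have : t (i + d + 1) - t i ≠ 0 := fun h' => h (by linarith)
        field_simp
        ring
    simp only [bspline]
    rw [e2, e1]
    ring
  rw [Finset.sum_congr rfl fun i _ => key i, Finset.sum_add_distrib,
    Finset.sum_range_sub (fun i => (t (i + d + 1) - x) / (t (i + d + 1) - t i) * bspline t d i x),
    bspline_eq_zero_of_knots_eq ht d n x hn,
    bspline_eq_zero_of_knots_eq ht d 0 x (by simpa using h0)]
  ring

theorem sum_bspline_zero {t : ℕ → ℝ} (ht : Monotone t) (n : ℕ) (h0 : t 0 = 0) (hn : t n = 1)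
    (hle : ∀ i, t i ≤ 1) {x : ℝ} (hx : x ∈ Set.Icc (0 : ℝ) 1) :
    ∑ i ∈ Finset.range n, bspline t 0 i x = 1 := by
  rcases hx.2.lt_or_eq with hx1 | hx1
  · have key : ∀ i, bspline t 0 i x =
        (if t i ≤ x then 1 else 0) - if t (i + 1) ≤ x then 1 else 0 := by
      intro i
      have hi := ht (Nat.le_succ i)
      simp only [Nat.succ_eq_add_one] at hi
      simp only [bspline]
      by_cases h1 : t (i + 1) ≤ x
      · have : t i ≤ x := hi.trans h1
        simp [h1, this, hx1.ne]
      · by_cases h2 : t i ≤ x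
        · simp [h1, h2, not_le.1 h1]
        · simp [h1, h2]
    rw [Finset.sum_congr rfl fun i _ => key i,
      Finset.sum_range_sub' (fun i => if t i ≤ x then (1 : ℝ) else 0)]
    simp [h0, hn, hx.1, hx1]
  · subst hx1
    have key : ∀ i, bspline t 0 i 1 =
        (if t i < 1 then 1 else 0) - if t (i + 1) < 1 then 1 else 0 := by
      intro i
      have hi := ht (Nat.le_succ i)
      simp only [Nat.succ_eq_add_one] at hi
      have hi1 := hle (i + 1)
      simp only [bspline]
      by_cases h1 : t (i + 1) < 1
      · have h2 : t i < 1 := hi.trans_lt h1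
        simp [h1, h2, h1.ne, not_lt.2 h1.le]
      · have h3 : t (i + 1) = 1 := le_antisymm hi1 (not_lt.1 h1)
        by_cases h2 : t i < 1
        · simp [h3, h2, h2.le]
        · simp [h3, h2]
    rw [Finset.sum_congr rfl fun i _ => key i,
      Finset.sum_range_sub' (fun i => if t i < 1 then (1 : ℝ) else 0)]
    simp [h0, hn]

section Basis

variable {K : ℕ}

theorem Knots.pt_mem_Icc (ξ : Knots K) (j : Fin (K + 2)) : ξ.pt j ∈ Set.Icc (0 : ℝ) 1 := by
  constructor
  · rw [← ξ.first]; exact ξ.strictMono.monotone (Fin.zero_le j)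
  · rw [← ξ.last]; exact ξ.strictMono.monotone (Fin.le_last j)

theorem Knots.ext_mem_Icc (ξ : Knots K) (m i : ℕ) : ξ.ext m i ∈ Set.Icc (0 : ℝ) 1 :=
  ξ.pt_mem_Icc _

theorem Knots.monotone_ext (ξ : Knots K) (m : ℕ) : Monotone (ξ.ext m) := by
  intro i j hij
  refine ξ.strictMono.monotone ?_
  rw [Fin.mk_le_mk]
  omega

theorem Knots.ext_eq_zero (ξ : Knots K) {m i : ℕ} (h : i < m) : ξ.ext m i = 0 := by
  rw [← ξ.first, Knots.ext]
  congr 1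
  rw [Fin.ext_iff]
  simp
  omega

theorem Knots.ext_eq_one (ξ : Knots K) {m i : ℕ} (h : K + m ≤ i) : ξ.ext m i = 1 := by
  rw [← ξ.last, Knots.ext]
  congr 1
  rw [Fin.ext_iff]
  simp
  omega

theorem Knots.basis_nonneg (ξ : Knots K) (m : ℕ) (k : Fin (K + m)) (x : ℝ) : 0 ≤ ξ.basis m k x :=
  bspline_nonneg (ξ.monotone_ext m) _ _ _

@[fun_prop]
theorem Knots.measurable_basis (ξ : Knots K) (m : ℕ) (k : Fin (K + m)) :
    Measurable (ξ.basis m k) :=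
  measurable_bspline _ _ _

theorem Knots.sum_basis (ξ : Knots K) {m : ℕ} (hm : 1 ≤ m) {x : ℝ} (hx : x ∈ Set.Icc (0 : ℝ) 1) :
    ∑ k, ξ.basis m k x = 1 := by
  have h : ∀ d, d < m → ∑ i ∈ Finset.range (K + m), bspline (ξ.ext m) d i x = 1 := by
    intro d
    induction d with
    | zero =>
      intro h
      exact sum_bspline_zero (ξ.monotone_ext m) _ (ξ.ext_eq_zero h) (ξ.ext_eq_one le_rfl)
        (fun i => (ξ.ext_mem_Icc m i).2) hx
    | succ d ih =>
      intro h
      rw [sum_bspline_succ (ξ.monotone_ext m), ih (by omega)]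
      · rw [ξ.ext_eq_zero (by omega), ξ.ext_eq_zero h]
      · rw [ξ.ext_eq_one le_rfl, ξ.ext_eq_one (by omega)]
  rw [← h (m - 1) (by omega), ← Fin.sum_univ_eq_sum_range]
  rfl

theorem Knots.mesh_nonneg (ξ : Knots K) : 0 ≤ ξ.mesh :=
  Real.iSup_nonneg fun _ => sub_nonneg.2 (ξ.strictMono.monotone (Fin.castSucc_lt_succ).le)

theorem Knots.ext_succ_sub_le (ξ : Knots K) (m i : ℕ) : ξ.ext m (i + 1) - ξ.ext m i ≤ ξ.mesh := by
  by_cases h : min (i + 1 + 1 - m) (K + 1) = min (i + 1 - m) (K + 1)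
  · have : ξ.ext m (i + 1) = ξ.ext m i := by simp only [Knots.ext, h]
    rw [this, sub_self]
    exact ξ.mesh_nonneg
  · have hlt : min (i + 1 - m) (K + 1) < K + 1 := by omega
    have := le_ciSup (f := fun j : Fin (K + 1) => ξ.pt j.succ - ξ.pt j.castSucc)
      (Set.finite_range _).bddAbove ⟨_, hlt⟩
    refine le_trans (le_of_eq ?_) this
    simp only [Knots.ext]
    congr 2
    rw [Fin.ext_iff]
    simp
    omega

theorem Knots.ext_add_sub_le (ξ : Knots K) (m i d : ℕ) :
    ξ.ext m (i + d) - ξ.ext m i ≤ d * ξ.mesh := by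
  induction d with
  | zero => simp
  | succ d ih =>
    have := ξ.ext_succ_sub_le m (i + d)
    push_cast
    rw [← add_assoc]
    linarith

/-- Where the `k`-th B-spline is nonzero, its left-most knot is within `m` mesh widths. -/
theorem Knots.abs_sub_ext_le (ξ : Knots K) {m : ℕ} (hm : 1 ≤ m) (k : Fin (K + m)) {x : ℝ}
    (h : ξ.basis m k x ≠ 0) : |x - ξ.ext m k| ≤ m * ξ.mesh := by
  obtain ⟨h1, h2⟩ := bspline_mem_support (ξ.monotone_ext m) _ _ _ h
  have h3 := ξ.ext_add_sub_le m k m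
  rw [show (k : ℕ) + (m - 1) + 1 = k + m by omega] at h2
  rw [abs_of_nonneg (by linarith)]
  linarith

/-- A spline deviates from `y` at most as much as those of its coefficients that matter. -/
theorem Knots.abs_spline_sub_le (ξ : Knots K) {m : ℕ} (hm : 1 ≤ m) {x : ℝ}
    (hx : x ∈ Set.Icc (0 : ℝ) 1) (c : Fin (K + m) → ℝ) (y ε : ℝ)
    (h : ∀ k, ξ.basis m k x ≠ 0 → |c k - y| ≤ ε) :
    |∑ k, c k * ξ.basis m k x - y| ≤ ε := by
  have h1 : ∑ k, c k * ξ.basis m k x - y = ∑ k, (c k - y) * ξ.basis m k x := by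
    simp_rw [sub_mul]
    rw [Finset.sum_sub_distrib, ← Finset.mul_sum, ξ.sum_basis hm hx, mul_one]
  rw [h1]
  calc |∑ k, (c k - y) * ξ.basis m k x| ≤ ∑ k, |(c k - y) * ξ.basis m k x| :=
        Finset.abs_sum_le_sum_abs _ _
    _ ≤ ∑ k, ε * ξ.basis m k x := by
        refine Finset.sum_le_sum fun k _ => ?_
        rw [abs_mul, abs_of_nonneg (ξ.basis_nonneg m k x)]
        by_cases h0 : ξ.basis m k x = 0
        · simp [h0]
        · exact mul_le_mul_of_nonneg_right (h k h0) (ξ.basis_nonneg m k x)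
    _ = ε := by rw [← Finset.mul_sum, ξ.sum_basis hm hx, mul_one]

theorem Knots.abs_spline_le (ξ : Knots K) {m : ℕ} (hm : 1 ≤ m) {x : ℝ}
    (hx : x ∈ Set.Icc (0 : ℝ) 1) (c : Fin (K + m) → ℝ) {ε : ℝ} (h : ∀ k, |c k| ≤ ε) :
    |∑ k, c k * ξ.basis m k x| ≤ ε := by
  simpa using ξ.abs_spline_sub_le hm hx c 0 ε (by simpa using fun k _ => h k)

theorem Knots.intervalIntegrable_spline (ξ : Knots K) {m : ℕ} (hm : 1 ≤ m)
    (c : Fin (K + m) → ℝ) :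
    IntervalIntegrable (fun x => ∑ k, c k * ξ.basis m k x) volume 0 1 := by
  rw [intervalIntegrable_iff_integrableOn_Icc_of_le zero_le_one]
  refine Measure.integrableOn_of_bounded (M := ∑ k, |c k|) (by simp) (by fun_prop) ?_
  refine (ae_restrict_mem measurableSet_Icc).mono fun x hx => ?_
  exact ξ.abs_spline_le hm hx c fun k =>
    Finset.single_le_sum (f := fun k => |c k|) (fun _ _ => abs_nonneg _) (Finset.mem_univ k)

/-- A continuous centered function bounded by `q` is uniformly approximated, as the mesh tends
to zero, by centered splines whose coefficients are bounded by the same `q`. The coefficients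
`u(t_k)` of the Schoenberg spline `S` are shifted by `d = ∫ S` to center it, and then shrunk by
the factor `q / (q + |d|)` to restore the bound. -/
theorem exists_centered_spline {m : ℕ} (hm : 1 ≤ m) {u : ℝ → ℝ} {q : ℝ}
    (hu : ContinuousOn u (Set.Icc 0 1)) (hu0 : ∫ x in (0 : ℝ)..1, u x = 0)
    (hq : ∀ x ∈ Set.Icc (0 : ℝ) 1, |u x| ≤ q) {ε : ℝ} (hε : 0 < ε) :
    ∃ δ > 0, ∀ (K : ℕ) (ξ : Knots K), ξ.mesh < δ → ∃ c : Fin (K + m) → ℝ, (∀ k, |c k| ≤ q) ∧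
      ∫ x in (0 : ℝ)..1, ∑ k, c k * ξ.basis m k x = 0 ∧
      ∀ x ∈ Set.Icc (0 : ℝ) 1, |∑ k, c k * ξ.basis m k x - u x| ≤ ε := by
  have hq0 : 0 ≤ q := (abs_nonneg _).trans (hq 0 (by simp))
  rcases hq0.eq_or_lt with rfl | hq0
  · refine ⟨1, one_pos, fun K ξ _ => ⟨0, by simp, by simp, fun x hx => ?_⟩⟩
    simp [abs_nonpos_iff.1 (hq x hx), hε.le]
  have huc : UniformContinuousOn u (Set.Icc 0 1) :=
    isCompact_Icc.uniformContinuousOn_of_continuous hu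
  obtain ⟨δ, hδ, hu'⟩ := Metric.uniformContinuousOn_iff.1 huc (ε / 3) (by positivity)
  have hm0 : (0 : ℝ) < m := by exact_mod_cast hm
  refine ⟨δ / m, by positivity, fun K ξ hξ => ?_⟩
  have hS : ∀ x ∈ Set.Icc (0 : ℝ) 1,
      |∑ k : Fin (K + m), u (ξ.ext m k) * ξ.basis m k x - u x| ≤ ε / 3 := by
    intro x hx
    refine ξ.abs_spline_sub_le hm hx _ _ _ fun k hk => ?_
    refine (hu' _ (ξ.ext_mem_Icc m k) x hx ?_).le
    rw [dist_comm, Real.dist_eq]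
    refine (ξ.abs_sub_ext_le hm k hk).trans_lt ?_
    rwa [lt_div_iff₀' hm0] at hξ
  have hSb : ∀ x ∈ Set.Icc (0 : ℝ) 1,
      |∑ k : Fin (K + m), u (ξ.ext m k) * ξ.basis m k x| ≤ q := fun x hx =>
    ξ.abs_spline_le hm hx _ fun k => hq _ (ξ.ext_mem_Icc m k)
  have hSi := ξ.intervalIntegrable_spline hm (fun k => u (ξ.ext m k))
  set S : ℝ → ℝ := fun x => ∑ k : Fin (K + m), u (ξ.ext m k) * ξ.basis m k x with hSdef
  set d : ℝ := ∫ x in (0 : ℝ)..1, S x with hd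
  have hui : IntervalIntegrable u volume 0 1 :=
    ContinuousOn.intervalIntegrable (by rwa [Set.uIcc_of_le zero_le_one])
  have hdε : |d| ≤ ε / 3 := by
    have h1 : d = ∫ x in (0 : ℝ)..1, (S x - u x) := by
      rw [intervalIntegral.integral_sub hSi hui, hu0, sub_zero]
    rw [h1]
    have := intervalIntegral.norm_integral_le_of_norm_le_const (a := (0 : ℝ)) (b := 1)
      (C := ε / 3) (f := fun x => S x - u x) (fun x hx => by
        rw [Set.uIoc_of_le zero_le_one] at hx
        exact hS x ⟨hx.1.le, hx.2⟩)
    simpa using this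
  have hpos : 0 < q + |d| := by positivity
  have hspl : ∀ x ∈ Set.Icc (0 : ℝ) 1,
      ∑ k : Fin (K + m), (q / (q + |d|) * (u (ξ.ext m k) - d)) * ξ.basis m k x
        = q / (q + |d|) * (S x - d) := by
    intro x hx
    simp_rw [mul_assoc, sub_mul]
    rw [← Finset.mul_sum, Finset.sum_sub_distrib, ← Finset.mul_sum, ξ.sum_basis hm hx, mul_one]
  refine ⟨fun k => q / (q + |d|) * (u (ξ.ext m k) - d), fun k => ?_, ?_, fun x hx => ?_⟩
  · rw [abs_mul, abs_of_pos (by positivity), div_mul_eq_mul_div, div_le_iff₀ hpos]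
    refine mul_le_mul_of_nonneg_left ?_ hq0.le
    exact (abs_sub _ _).trans (add_le_add (hq _ (ξ.ext_mem_Icc m k)) le_rfl)
  · rw [intervalIntegral.integral_congr (g := fun x => q / (q + |d|) * (S x - d))
      (fun x hx => hspl x (by rwa [Set.uIcc_of_le zero_le_one] at hx)),
      intervalIntegral.integral_const_mul, intervalIntegral.integral_sub hSi (by simp), ← hd]
    simp
  · rw [hspl x hx]
    have h1 : q / (q + |d|) * (S x - d) - u x
        = (S x - u x) - d - |d| * ((S x - d) / (q + |d|)) := by
      field_simp
      ring
    have h2 : |(S x - d) / (q + |d|)| ≤ 1 := by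
      rw [abs_div, abs_of_pos hpos, div_le_one hpos]
      exact (abs_sub _ _).trans (add_le_add (hSb x hx) le_rfl)
    have h3 : |(|d| * ((S x - d) / (q + |d|)))| ≤ ε / 3 := by
      rw [abs_mul, abs_abs]
      exact (mul_le_mul_of_nonneg_left h2 (abs_nonneg d)).trans (by rwa [mul_one])
    rw [h1]
    have h4 := hS x hx
    rw [abs_le] at h3 h4 hdε ⊢
    constructor <;> linarith [h3.1, h3.2, h4.1, h4.2, hdε.1, hdε.2]

end Basis

/-! ### Bounded parameters and the odds of being unlabeled -/

/-- The conditional odds of being unlabeled given the features, `V = π + (1 - π) exp(-(α + η))`,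
up to the factor `ρ`: when the sample sizes have ratio `ρ`, a pooled observation at `x` is
labeled with probability `ρ / (ρ + V x)` and unlabeled with probability `V x / (ρ + V x)`. -/
def Param.unlOdds {p : ℕ} (θ : Param p) (x : Fin p → ℝ) : ℝ :=
  θ.prop + (1 - θ.prop) * Real.exp (-(θ.alpha + θ.eta x))

/-- The parameter satisfies the bounds that define the sieve, with the bound on the coefficients
replaced by the bound it implies for the components. -/
structure Param.IsBounded {p : ℕ} (πlow M : ℝ) (q : Fin p → ℝ) (θ : Param p) : Prop where
  prop_mem : θ.prop ∈ Set.Icc πlow (1 - πlow)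
  abs_alpha_le : |θ.alpha| ≤ M
  abs_comp_le : ∀ j, ∀ x ∈ Set.Icc (0 : ℝ) 1, |θ.comp j x| ≤ q j

/-- A bounded parameter whose components are measurable on `ℝ` and centered on `[0,1]`. -/
structure Param.IsRegular {p : ℕ} (πlow M : ℝ) (q : Fin p → ℝ) (θ : Param p) : Prop extends
    Param.IsBounded πlow M q θ where
  measurable_comp : ∀ j, Measurable (θ.comp j)
  integral_comp : ∀ j, ∫ x in (0 : ℝ)..1, θ.comp j x = 0

/-- The common bound of `|α + η|` on the unit cube for all bounded parameters. -/
def predBound {p : ℕ} (M : ℝ) (q : Fin p → ℝ) : ℝ := M + ∑ j, q j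

theorem abs_exp_sub_exp_le {a b B : ℝ} (ha : a ≤ B) (hb : b ≤ B) :
    |Real.exp a - Real.exp b| ≤ Real.exp B * |a - b| := by
  have key : ∀ a b : ℝ, a ≤ B → Real.exp a - Real.exp b ≤ Real.exp B * |a - b| := by
    intro a b ha
    have h1 : Real.exp b = Real.exp a * Real.exp (b - a) := by rw [← Real.exp_add]; ring_nf
    have h2 := Real.add_one_le_exp (b - a)
    have h3 := Real.exp_pos a
    calc Real.exp a - Real.exp b = Real.exp a * (1 - Real.exp (b - a)) := by rw [h1]; ring
      _ ≤ Real.exp a * (a - b) := mul_le_mul_of_nonneg_left (by linarith) h3.le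
      _ ≤ Real.exp a * |a - b| := mul_le_mul_of_nonneg_left (le_abs_self _) h3.le
      _ ≤ Real.exp B * |a - b| :=
        mul_le_mul_of_nonneg_right (Real.exp_le_exp.2 ha) (abs_nonneg _)
  rw [abs_sub_le_iff]
  exact ⟨key a b ha, by rw [abs_sub_comm]; exact key b a hb⟩

theorem abs_log_sub_log_le {v w c : ℝ} (hc : 0 < c) (hv : c ≤ v) (hw : c ≤ w) :
    |Real.log v - Real.log w| ≤ c⁻¹ * |v - w| := by
  have key : ∀ v w : ℝ, c ≤ v → c ≤ w → Real.log v - Real.log w ≤ c⁻¹ * |v - w| := by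
    intro v w hv hw
    have hv0 := hc.trans_le hv
    have hw0 := hc.trans_le hw
    rw [← Real.log_div hv0.ne' hw0.ne']
    calc Real.log (v / w) ≤ v / w - 1 := Real.log_le_sub_one_of_pos (by positivity)
      _ = w⁻¹ * (v - w) := by field_simp
      _ ≤ w⁻¹ * |v - w| := mul_le_mul_of_nonneg_left (le_abs_self _) (by positivity)
      _ ≤ c⁻¹ * |v - w| := mul_le_mul_of_nonneg_right (inv_anti₀ hc hw) (abs_nonneg _)
  rw [abs_sub_le_iff]
  exact ⟨key v w hv hw, by rw [abs_sub_comm]; exact key w v hw hv⟩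

section Bounds

variable {p : ℕ} {πlow M : ℝ} {q : Fin p → ℝ} {θ θ' : Param p} {x : Fin p → ℝ}

theorem apply_mem_Icc (hx : x ∈ Set.Icc (0 : Fin p → ℝ) 1) (j : Fin p) :
    x j ∈ Set.Icc (0 : ℝ) 1 := ⟨hx.1 j, hx.2 j⟩

theorem Param.IsBounded.abs_eta_le (h : θ.IsBounded πlow M q)
    (hx : x ∈ Set.Icc (0 : Fin p → ℝ) 1) : |θ.eta x| ≤ ∑ j, q j :=
  (Finset.abs_sum_le_sum_abs _ _).trans
    (Finset.sum_le_sum fun j _ => h.abs_comp_le j _ (apply_mem_Icc hx j))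

theorem Param.IsBounded.abs_pred_le (h : θ.IsBounded πlow M q)
    (hx : x ∈ Set.Icc (0 : Fin p → ℝ) 1) : |θ.alpha + θ.eta x| ≤ predBound M q :=
  (abs_add_le _ _).trans (add_le_add h.abs_alpha_le (h.abs_eta_le hx))

theorem Param.IsBounded.predBound_nonneg (h : θ.IsBounded πlow M q) : 0 ≤ predBound M q :=
  add_nonneg ((abs_nonneg _).trans h.abs_alpha_le)
    (Finset.sum_nonneg fun j _ => (abs_nonneg _).trans (h.abs_comp_le j 0 (by simp)))

theorem Param.IsBounded.exp_neg_pred_mem (h : θ.IsBounded πlow M q)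
    (hx : x ∈ Set.Icc (0 : Fin p → ℝ) 1) : Real.exp (-(θ.alpha + θ.eta x)) ∈
      Set.Icc (Real.exp (-predBound M q)) (Real.exp (predBound M q)) := by
  have := abs_le.1 (h.abs_pred_le hx)
  exact ⟨Real.exp_le_exp.2 (by linarith), Real.exp_le_exp.2 (by linarith)⟩

theorem Param.IsBounded.prop_pos (h : θ.IsBounded πlow M q) (hπ : 0 < πlow) : 0 < θ.prop :=
  hπ.trans_le h.prop_mem.1

theorem Param.IsBounded.prop_lt_one (h : θ.IsBounded πlow M q) (hπ : 0 < πlow) : θ.prop < 1 := by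
  have := h.prop_mem.2
  linarith

theorem Param.IsBounded.unlOdds_mem (h : θ.IsBounded πlow M q) (hπ : 0 < πlow)
    (hx : x ∈ Set.Icc (0 : Fin p → ℝ) 1) : θ.unlOdds x ∈
      Set.Icc (Real.exp (-predBound M q)) (Real.exp (predBound M q)) := by
  obtain ⟨h1, h2⟩ := h.exp_neg_pred_mem hx
  have h3 := h.prop_pos hπ
  have h4 := h.prop_lt_one hπ
  have h5 : Real.exp (-predBound M q) ≤ 1 :=
    Real.exp_le_one_iff.2 (neg_nonpos.2 h.predBound_nonneg)
  have h6 : 1 ≤ Real.exp (predBound M q) := Real.one_le_exp h.predBound_nonneg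
  unfold Param.unlOdds
  constructor <;> nlinarith

/-- Two parameters are `δ`-close, uniformly on the unit cube. -/
structure Param.Close (δ : ℝ) (θ θ' : Param p) : Prop where
  prop : |θ.prop - θ'.prop| ≤ δ
  alpha : |θ.alpha - θ'.alpha| ≤ δ
  eta : ∀ x ∈ Set.Icc (0 : Fin p → ℝ) 1, |θ.eta x - θ'.eta x| ≤ δ

theorem Param.Close.abs_unlOdds_sub_le {δ : ℝ} (h : θ.Close δ θ') (hθ : θ.IsBounded πlow M q)
    (hθ' : θ'.IsBounded πlow M q) (hπ : 0 < πlow) (hx : x ∈ Set.Icc (0 : Fin p → ℝ) 1) :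
    |θ.unlOdds x - θ'.unlOdds x| ≤ 3 * Real.exp (predBound M q) * δ := by
  obtain ⟨h1, h2⟩ := hθ.exp_neg_pred_mem hx
  have h3 := hθ'.prop_pos hπ
  have h4 := hθ'.prop_lt_one hπ
  have hB : 1 ≤ Real.exp (predBound M q) := Real.one_le_exp hθ.predBound_nonneg
  have hL := abs_exp_sub_exp_le (by linarith [(abs_le.1 (hθ.abs_pred_le hx)).1] :
      -(θ.alpha + θ.eta x) ≤ predBound M q)
    (by linarith [(abs_le.1 (hθ'.abs_pred_le hx)).1] : -(θ'.alpha + θ'.eta x) ≤ predBound M q)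
  have hd : |-(θ.alpha + θ.eta x) - -(θ'.alpha + θ'.eta x)| ≤ 2 * δ := by
    have := abs_le.1 h.alpha
    have := abs_le.1 (h.eta x hx)
    rw [abs_le]
    constructor <;> linarith
  set G := Real.exp (-(θ.alpha + θ.eta x)) with hG
  set G' := Real.exp (-(θ'.alpha + θ'.eta x)) with hG'
  have hGpos : 0 < G := Real.exp_pos _
  have e : θ.unlOdds x - θ'.unlOdds x
      = (θ.prop - θ'.prop) * (1 - G) + (1 - θ'.prop) * (G - G') := by
    unfold Param.unlOdds
    rw [← hG, ← hG']
    ring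
  have hG1 : |1 - G| ≤ Real.exp (predBound M q) := by
    rw [abs_le]
    constructor <;> linarith
  have hδ : 0 ≤ δ := (abs_nonneg _).trans h.prop
  have hGG : |G - G'| ≤ Real.exp (predBound M q) * (2 * δ) :=
    hL.trans (mul_le_mul_of_nonneg_left hd (by linarith))
  rw [e]
  calc _ ≤ |θ.prop - θ'.prop| * |1 - G| + |1 - θ'.prop| * |G - G'| := by
        rw [← abs_mul, ← abs_mul]; exact abs_add_le _ _
    _ ≤ δ * Real.exp (predBound M q) + 1 * (Real.exp (predBound M q) * (2 * δ)) := by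
        refine add_le_add (mul_le_mul h.prop hG1 (abs_nonneg _) hδ)
          (mul_le_mul ?_ hGG (abs_nonneg _) zero_le_one)
        rw [abs_le]
        constructor <;> linarith
    _ = _ := by ring

theorem Param.Close.symm {δ : ℝ} (h : θ.Close δ θ') : θ'.Close δ θ :=
  ⟨abs_sub_comm θ.prop _ ▸ h.prop, abs_sub_comm θ.alpha _ ▸ h.alpha,
    fun x hx => abs_sub_comm (θ.eta x) _ ▸ h.eta x hx⟩

theorem Param.close_of_comp {δ ε : ℝ} (hε : (p + 1) * ε ≤ δ) (h1 : |θ.prop - θ'.prop| ≤ ε)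
    (h2 : |θ.alpha - θ'.alpha| ≤ ε)
    (h3 : ∀ j, ∀ x ∈ Set.Icc (0 : ℝ) 1, |θ.comp j x - θ'.comp j x| ≤ ε) : θ.Close δ θ' := by
  have hε0 : 0 ≤ ε := (abs_nonneg _).trans h1
  have hp : (0 : ℝ) ≤ p := p.cast_nonneg
  refine ⟨h1.trans (by nlinarith), h2.trans (by nlinarith), fun x hx => ?_⟩
  unfold Param.eta
  rw [← Finset.sum_sub_distrib]
  refine (Finset.abs_sum_le_sum_abs _ _).trans
    ((Finset.sum_le_sum fun j _ => h3 j _ (apply_mem_Icc hx j)).trans ?_)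
  simp
  nlinarith

theorem Param.IsRegular.measurable_eta (h : θ.IsRegular πlow M q) : Measurable θ.eta := by
  unfold Param.eta
  exact Finset.measurable_fun_sum _ fun j _ => (h.measurable_comp j).comp (measurable_pi_apply j)

theorem Param.IsRegular.measurable_unlOdds (h : θ.IsRegular πlow M q) : Measurable θ.unlOdds := by
  unfold Param.unlOdds
  have := h.measurable_eta
  fun_prop

end Bounds

/-! ### The sieve: approximation power and finite nets -/

/-- A bounded set of vectors has a `δ`-net, for the sup norm, that consists of its own elements
and whose size is exponential in the dimension: one vector for each cell of a grid. -/
theorem exists_finset_net {ι : Type*} [Fintype ι] (S : Set (ι → ℝ)) {δ : ℝ} (hδ : 0 < δ) (N : ℕ)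
    (hS : ∀ s ∈ S, ∀ i, |s i| ≤ N * δ) :
    ∃ T : Finset (ι → ℝ), (T : Set (ι → ℝ)) ⊆ S ∧ T.card ≤ (2 * N + 1) ^ Fintype.card ι ∧
      ∀ s ∈ S, ∃ t ∈ T, ∀ i, |s i - t i| ≤ δ := by
  classical
  set f : (ι → ℝ) → ι → ℤ := fun s i => ⌊s i / δ⌋ with hf
  set P : Finset (ι → ℤ) := Fintype.piFinset fun _ => Finset.Icc (-N : ℤ) N with hP
  have hmaps : f '' S ⊆ P := by
    rintro _ ⟨s, hs, rfl⟩
    rw [Finset.mem_coe, hP, Fintype.mem_piFinset]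
    intro i
    obtain ⟨h1, h2⟩ := abs_le.1 (hS s hs i)
    rw [Finset.mem_Icc]
    constructor
    · rw [hf, Int.le_floor, le_div_iff₀ hδ]
      push_cast
      linarith
    · have h3 : ((⌊s i / δ⌋ : ℤ) : ℝ) ≤ N := (Int.floor_le _).trans ((div_le_iff₀ hδ).2 h2)
      exact_mod_cast h3
  obtain ⟨T, hTS, hT⟩ := (Set.surjOn_image f S).exists_bijOn_subset
  have hfin : T.Finite := (hT.finite_iff_finite).2 (P.finite_toSet.subset hmaps)
  refine ⟨hfin.toFinset, by simpa using hTS, ?_, fun s hs => ?_⟩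
  · have h1 : hfin.toFinset.card ≤ P.card := by
      refine Finset.card_le_card_of_injOn f (fun t ht => hmaps ⟨t, hTS (by simpa using ht), rfl⟩) ?_
      simpa using hT.injOn
    refine h1.trans (le_of_eq ?_)
    rw [hP, Fintype.card_piFinset, Finset.prod_const, Finset.card_univ, Int.card_Icc]
    congr 1
    omega
  · obtain ⟨t, ht, hft⟩ := hT.surjOn (Set.mem_image_of_mem f hs)
    refine ⟨t, by simpa using ht, fun i => ?_⟩
    have := Int.abs_sub_lt_one_of_floor_eq_floor (congrFun hft i)
    rw [← sub_div, abs_div, abs_of_pos hδ, div_lt_one hδ] at this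
    rw [abs_sub_comm]
    exact this.le

/-- The spline parameter with the given mixture proportion, normalizing constant and B-spline
coefficients. -/
def splineParam {p K : ℕ} (m : ℕ) (ξ : Knots K) (a b : ℝ) (c : Fin p → Fin (K + m) → ℝ) :
    Param p where
  prop := a
  alpha := b
  comp j x := ∑ k, c j k * ξ.basis m k x

section Sieve

variable {p K m : ℕ} {πlow M : ℝ} {q : Fin p → ℝ}

theorem isBounded_of_mem_sieve (hm : 1 ≤ m) {ξ : Knots K} {θ : Param p}
    (hθ : θ ∈ sieve m ξ πlow M q) : θ.IsBounded πlow M q := by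
  refine ⟨hθ.1, hθ.2.1, fun j x hx => ?_⟩
  obtain ⟨c, hc, hcx, -⟩ := hθ.2.2 j
  rw [hcx x hx]
  exact ξ.abs_spline_le hm hx c hc

theorem isRegular_splineParam (hm : 1 ≤ m) (ξ : Knots K) {a b : ℝ}
    {c : Fin p → Fin (K + m) → ℝ} (ha : a ∈ Set.Icc πlow (1 - πlow)) (hb : |b| ≤ M)
    (hc : ∀ j k, |c j k| ≤ q j)
    (h0 : ∀ j, ∫ x in (0 : ℝ)..1, ∑ k, c j k * ξ.basis m k x = 0) :
    (splineParam m ξ a b c).IsRegular πlow M q where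
  prop_mem := ha
  abs_alpha_le := hb
  abs_comp_le j _ hx := ξ.abs_spline_le hm hx (c j) (hc j)
  measurable_comp j := by
    change Measurable fun x => ∑ k, c j k * ξ.basis m k x
    fun_prop
  integral_comp := h0

/-- For every `δ`, the sieve has a `δ`-net of regular parameters whose size is exponential in the
number of knots, with a base that does not depend on the knots. -/
theorem exists_sieve_net (hm : 1 ≤ m) (πlow M : ℝ) (hπ : 0 ≤ πlow) (q : Fin p → ℝ) {δ : ℝ}
    (hδ : 0 < δ) :
    ∃ A : ℕ, 0 < A ∧ ∀ (K : ℕ) (ξ : Knots K), ∃ T : Finset (Param p),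
      T.card ≤ A ^ (2 + p * (K + m)) ∧ (∀ θ ∈ T, θ.IsRegular πlow M q) ∧
      ∀ θ ∈ sieve m ξ πlow M q, ∃ θ' ∈ T, θ.Close δ θ' := by
  classical
  set ε : ℝ := δ / (p + 1) with hε
  have hε0 : 0 < ε := by positivity
  set R : ℝ := 1 + |M| + ∑ j, |q j| with hR
  obtain ⟨N, hN⟩ := exists_nat_ge (R / ε)
  rw [div_le_iff₀ hε0] at hN
  have hqR : ∀ j, q j ≤ R := fun j => by
    have := Finset.single_le_sum (f := fun j => |q j|) (fun _ _ => abs_nonneg _) (Finset.mem_univ j)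
    linarith [le_abs_self (q j), abs_nonneg M]
  have hsum : 0 ≤ ∑ j, |q j| := Finset.sum_nonneg fun _ _ => abs_nonneg _
  refine ⟨2 * N + 1, by omega, fun K ξ => ?_⟩
  -- coordinates: `inl true` is `π`, `inl false` is `α`, `inr (j, k)` is a spline coefficient
  set toParam : (Bool ⊕ (Fin p × Fin (K + m)) → ℝ) → Param p := fun s =>
    splineParam m ξ (s (.inl true)) (s (.inl false)) fun j k => s (.inr (j, k)) with hto
  obtain ⟨T, hTS, hcard, hT⟩ := exists_finset_net (ι := Bool ⊕ (Fin p × Fin (K + m)))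
    {s | s (.inl true) ∈ Set.Icc πlow (1 - πlow) ∧ |s (.inl false)| ≤ M ∧
      (∀ j k, |s (.inr (j, k))| ≤ q j) ∧
      ∀ j, ∫ x in (0 : ℝ)..1, ∑ k, s (.inr (j, k)) * ξ.basis m k x = 0} hε0 N (by
    rintro s ⟨h1, h2, h3, -⟩ ((_ | _) | ⟨j, k⟩)
    · linarith [le_abs_self M]
    · rw [abs_of_nonneg (hπ.trans h1.1)]
      linarith [h1.2, abs_nonneg M]
    · linarith [h3 j k, hqR j])
  refine ⟨T.image toParam, Finset.card_image_le.trans (by simpa using hcard), ?_, ?_⟩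
  · intro θ hθ
    obtain ⟨s, hs, rfl⟩ := Finset.mem_image.1 hθ
    obtain ⟨h1, h2, h3, h4⟩ := hTS hs
    exact isRegular_splineParam hm ξ h1 h2 h3 h4
  · intro θ hθ
    choose c hc hcx hc0 using hθ.2.2
    obtain ⟨t, ht, hst⟩ := hT (Sum.elim (fun b => if b then θ.prop else θ.alpha)
      fun jk => c jk.1 jk.2) ⟨by simpa using hθ.1, by simpa using hθ.2.1, by simpa using hc, by
        intro j
        refine (intervalIntegral.integral_congr fun x hx => ?_).trans (hc0 j)
        rw [Set.uIcc_of_le zero_le_one] at hx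
        simp [hcx j x hx]⟩
    refine ⟨toParam t, Finset.mem_image_of_mem _ ht, Param.close_of_comp (ε := ε) ?_ ?_ ?_ ?_⟩
    · rw [hε]
      field_simp
      exact le_rfl
    · simpa [hto, splineParam] using hst (.inl true)
    · simpa [hto, splineParam] using hst (.inl false)
    · intro j x hx
      rw [hcx j x hx]
      change |∑ k, c j k * ξ.basis m k x - ∑ k, t (.inr (j, k)) * ξ.basis m k x| ≤ ε
      rw [← Finset.sum_sub_distrib]
      simp_rw [← sub_mul]
      exact ξ.abs_spline_le hm hx _ fun k => by simpa using hst (.inr (j, k))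

/-- A regular parameter with continuous components is approximated by the sieve. -/
theorem exists_mem_sieve_close (hm : 1 ≤ m) {θ : Param p} (hθ : θ.IsRegular πlow M q)
    (hc : ∀ j, ContinuousOn (θ.comp j) (Set.Icc 0 1)) {δ : ℝ} (hδ : 0 < δ) :
    ∃ r > 0, ∀ (K : ℕ) (ξ : Knots K), ξ.mesh < r →
      ∃ θ' ∈ sieve m ξ πlow M q, θ'.Close δ θ := by
  have hε0 : 0 < δ / (p + 1) := by positivity
  choose r hr hspl using fun j =>
    exists_centered_spline hm (hc j) (hθ.integral_comp j) (hθ.abs_comp_le j) hε0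
  obtain ⟨r₀, hr₀, hle⟩ : ∃ r₀ > 0, ∀ j, r₀ ≤ r j := by
    rcases isEmpty_or_nonempty (Fin p) with hp | hp
    · exact ⟨1, one_pos, fun j => hp.elim j⟩
    · obtain ⟨j₀, hj₀⟩ := Finite.exists_min r
      exact ⟨r j₀, hr j₀, hj₀⟩
  refine ⟨r₀, hr₀, fun K ξ hξ => ?_⟩
  choose c hcq hc0 hcx using fun j => hspl j K ξ (hξ.trans_le (hle j))
  refine ⟨splineParam m ξ θ.prop θ.alpha c, ⟨hθ.prop_mem, hθ.abs_alpha_le, fun j =>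
    ⟨c j, hcq j, fun _ _ => rfl, hc0 j⟩⟩, Param.close_of_comp (ε := δ / (p + 1)) ?_ ?_ ?_ hcx⟩
  · field_simp
    exact le_rfl
  · simp [splineParam, hε0.le]
  · simp [splineParam, hε0.le]

end Sieve

/-! ### The log-likelihood in terms of the odds -/

/-- The log-likelihood of a labeled observation with odds `v`, up to the constant `log ρ`. -/
def labTerm (ρ v : ℝ) : ℝ := -Real.log (ρ + v)

/-- The log-likelihood of an unlabeled observation with odds `v`. -/
def unlTerm (ρ v : ℝ) : ℝ := Real.log v - Real.log (ρ + v)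

theorem profileLogLik_eq {p n₀ n₁ : ℕ} {ρ : ℝ} (hρ : 0 < ρ) (hn₁ : 0 < n₁)
    (hn : (n₀ : ℝ) = ρ * n₁) (x : Fin (n₀ + n₁) → Fin p → ℝ) {θ : Param p} (h0 : 0 < θ.prop)
    (h1 : θ.prop < 1) : profileLogLik x θ = n₀ * Real.log ρ +
      (∑ i : Fin n₀, labTerm ρ (θ.unlOdds (x (Fin.castAdd n₁ i))) +
        ∑ i : Fin n₁, unlTerm ρ (θ.unlOdds (x (Fin.natAdd n₀ i)))) := by
  have hn₁' : (0 : ℝ) < n₁ := by exact_mod_cast hn₁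
  have h1' : 0 < 1 - θ.prop := by linarith
  have htilt : ∀ y, θ.tilt y = Real.exp (θ.alpha + θ.eta y) * (θ.prop / (1 - θ.prop)) := by
    intro y
    rw [Param.tilt, Real.exp_sub, Real.exp_log (by positivity)]
    field_simp
  have hodds : ∀ y, θ.unlOdds y = θ.prop + (1 - θ.prop) / Real.exp (θ.alpha + θ.eta y) := by
    intro y
    rw [Param.unlOdds, Real.exp_neg, div_eq_mul_inv]
  have hpos : ∀ y, 0 < θ.unlOdds y := by
    intro y
    rw [hodds]
    positivity
  have hlab : ∀ y, Real.log ((n₀ * θ.tilt y) / (n₁ * θ.prop + (n₀ + n₁ * θ.prop) * θ.tilt y))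
      = Real.log ρ + labTerm ρ (θ.unlOdds y) := by
    intro y
    have := hpos y
    rw [labTerm, ← sub_eq_add_neg, ← Real.log_div hρ.ne' (by positivity), htilt, hodds, hn]
    congr 1
    have := Real.exp_pos (θ.alpha + θ.eta y)
    field_simp
    ring
  have hunl : ∀ y, Real.log ((n₁ * θ.prop + n₁ * θ.prop * θ.tilt y) /
      (n₁ * θ.prop + (n₀ + n₁ * θ.prop) * θ.tilt y)) = unlTerm ρ (θ.unlOdds y) := by
    intro y
    have := hpos y
    rw [unlTerm, ← Real.log_div this.ne' (by positivity), htilt, hodds, hn]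
    congr 1
    have := Real.exp_pos (θ.alpha + θ.eta y)
    field_simp
    ring
  unfold profileLogLik
  simp_rw [hlab, hunl]
  rw [Finset.sum_add_distrib]
  simp
  ring

section Terms

variable {ρ v w B : ℝ}

theorem abs_labTerm_sub_le (hρ : 0 < ρ) (hv : Real.exp (-B) ≤ v) (hw : Real.exp (-B) ≤ w) :
    |labTerm ρ v - labTerm ρ w| ≤ 2 * Real.exp B * |v - w| := by
  have h := abs_log_sub_log_le (Real.exp_pos (-B)) (by linarith : Real.exp (-B) ≤ ρ + v)
    (by linarith : Real.exp (-B) ≤ ρ + w)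
  rw [Real.exp_neg, inv_inv, add_sub_add_left_eq_sub] at h
  have h2 : labTerm ρ v - labTerm ρ w = -(Real.log (ρ + v) - Real.log (ρ + w)) := by
    unfold labTerm; ring
  rw [h2, abs_neg]
  have := mul_nonneg (Real.exp_pos B).le (abs_nonneg (v - w))
  linarith

theorem abs_unlTerm_sub_le (hρ : 0 < ρ) (hv : Real.exp (-B) ≤ v) (hw : Real.exp (-B) ≤ w) :
    |unlTerm ρ v - unlTerm ρ w| ≤ 2 * Real.exp B * |v - w| := by
  have h := abs_log_sub_log_le (Real.exp_pos (-B)) (by linarith : Real.exp (-B) ≤ ρ + v)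
    (by linarith : Real.exp (-B) ≤ ρ + w)
  have h' := abs_log_sub_log_le (Real.exp_pos (-B)) hv hw
  rw [Real.exp_neg, inv_inv] at h h'
  rw [add_sub_add_left_eq_sub] at h
  have h2 : unlTerm ρ v - unlTerm ρ w
      = (Real.log v - Real.log w) - (Real.log (ρ + v) - Real.log (ρ + w)) := by
    unfold unlTerm; ring
  rw [h2]
  have := abs_sub (Real.log v - Real.log w) (Real.log (ρ + v) - Real.log (ρ + w))
  linarith

theorem abs_log_le_of_mem (hv : v ∈ Set.Icc (Real.exp (-B)) (Real.exp B)) : |Real.log v| ≤ B := by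
  have hv0 : 0 < v := (Real.exp_pos _).trans_le hv.1
  exact abs_le.2 ⟨(Real.le_log_iff_exp_le hv0).2 hv.1, (Real.log_le_iff_le_exp hv0).2 hv.2⟩

theorem abs_log_add_le (hρ : 0 < ρ) (hB : 0 ≤ B)
    (hv : v ∈ Set.Icc (Real.exp (-B)) (Real.exp B)) :
    |Real.log (ρ + v)| ≤ B + ρ + Real.exp B := by
  have hv0 : 0 < v := (Real.exp_pos _).trans_le hv.1
  have h1 : -B ≤ Real.log (ρ + v) :=
    (Real.le_log_iff_exp_le (by positivity)).2 (by linarith [hv.1])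
  have h2 := Real.log_le_sub_one_of_pos (by positivity : 0 < ρ + v)
  rw [abs_le]
  constructor <;> linarith [Real.exp_pos B, hv.2]

/-- A bound for the two log-likelihood terms when the odds lie in `[e^{-B}, e^B]`. -/
def termBound (ρ B : ℝ) : ℝ := 2 * B + ρ + Real.exp B

theorem termBound_pos (hρ : 0 < ρ) (hB : 0 ≤ B) : 0 < termBound ρ B := by
  unfold termBound; positivity

theorem abs_labTerm_le (hρ : 0 < ρ) (hB : 0 ≤ B)
    (hv : v ∈ Set.Icc (Real.exp (-B)) (Real.exp B)) : |labTerm ρ v| ≤ termBound ρ B := by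
  have := abs_log_add_le hρ hB hv
  rw [labTerm, abs_neg, termBound]
  linarith

theorem abs_unlTerm_le (hρ : 0 < ρ) (hB : 0 ≤ B)
    (hv : v ∈ Set.Icc (Real.exp (-B)) (Real.exp B)) : |unlTerm ρ v| ≤ termBound ρ B := by
  have h1 := abs_log_add_le hρ hB hv
  have h2 := abs_log_le_of_mem hv
  have h3 := abs_sub (Real.log v) (Real.log (ρ + v))
  rw [unlTerm, termBound]
  linarith

@[fun_prop]
theorem measurable_labTerm (ρ : ℝ) : Measurable (labTerm ρ) := by unfold labTerm; fun_prop

@[fun_prop]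
theorem measurable_unlTerm (ρ : ℝ) : Measurable (unlTerm ρ) := by unfold unlTerm; fun_prop

/-- The expected log-likelihood gap at one point between the true odds `v` and other odds `w` is a
Kullback-Leibler divergence of two Bernoulli laws. It dominates the squared Hellinger distance,
because `log y ≤ 2 (√y - 1)`, and therefore a multiple of `(v - w) ^ 2`. -/
theorem sq_sub_le_term_gap (hρ : 0 < ρ) (hv : v ∈ Set.Icc (Real.exp (-B)) (Real.exp B))
    (hw : w ∈ Set.Icc (Real.exp (-B)) (Real.exp B)) :
    ρ ^ 2 / (4 * (ρ + Real.exp B) ^ 3) * (v - w) ^ 2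
      ≤ ρ * (labTerm ρ v - labTerm ρ w) + v * (unlTerm ρ v - unlTerm ρ w) := by
  have hv0 : 0 < v := (Real.exp_pos _).trans_le hv.1
  have hw0 : 0 < w := (Real.exp_pos _).trans_le hw.1
  -- the probabilities of the label under the two odds
  set s : ℝ := ρ / (ρ + v) with hs
  set r : ℝ := ρ / (ρ + w) with hr
  have hs0 : 0 < s := by positivity
  have hr0 : 0 < r := by positivity
  have hs1 : 1 - s = v / (ρ + v) := by rw [hs]; field_simp; ring
  have hr1 : 1 - r = w / (ρ + w) := by rw [hr]; field_simp; ring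
  have hs1' : 0 < 1 - s := by rw [hs1]; positivity
  have hr1' : 0 < 1 - r := by rw [hr1]; positivity
  have hlog : ∀ a b : ℝ, 0 < a → 0 < b →
      2 * a - 2 * (Real.sqrt a * Real.sqrt b) ≤ a * (Real.log a - Real.log b) := by
    intro a b ha hb
    have ha' := Real.sqrt_pos.2 ha
    have hb' := Real.sqrt_pos.2 hb
    have h := Real.log_le_sub_one_of_pos (div_pos hb' ha')
    rw [Real.log_div hb'.ne' ha'.ne', Real.log_sqrt hb.le, Real.log_sqrt ha.le] at h
    have h2 : a * (Real.sqrt b / Real.sqrt a) = Real.sqrt a * Real.sqrt b := by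
      nth_rw 1 [← Real.mul_self_sqrt ha.le]
      field_simp
    nlinarith
  have hell : ∀ a b : ℝ, 0 < a → a ≤ 1 → 0 < b → b ≤ 1 →
      (a - b) ^ 2 / 4 ≤ a + b - 2 * (Real.sqrt a * Real.sqrt b) := by
    intro a b ha ha1 hb hb1
    have ha' := Real.sqrt_pos.2 ha
    have hb' := Real.sqrt_pos.2 hb
    have ha2 : Real.sqrt a ≤ 1 := Real.sqrt_le_one.2 ha1
    have hb2 : Real.sqrt b ≤ 1 := Real.sqrt_le_one.2 hb1
    have e1 : a = Real.sqrt a ^ 2 := (Real.sq_sqrt ha.le).symm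
    have e2 : b = Real.sqrt b ^ 2 := (Real.sq_sqrt hb.le).symm
    have e3 : (a - b) ^ 2
        = (Real.sqrt a - Real.sqrt b) ^ 2 * (Real.sqrt a + Real.sqrt b) ^ 2 := by
      nth_rw 1 [e1, e2]
      ring
    have e4 : (Real.sqrt a + Real.sqrt b) ^ 2 ≤ 4 := by nlinarith
    have e5 : a + b - 2 * (Real.sqrt a * Real.sqrt b) = (Real.sqrt a - Real.sqrt b) ^ 2 := by
      nth_rw 1 [e1, e2]
      ring
    rw [e3, e5]
    nlinarith [sq_nonneg (Real.sqrt a - Real.sqrt b)]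
  have l1 := hlog s r hs0 hr0
  have l2 := hlog (1 - s) (1 - r) hs1' hr1'
  have l3 := hell s r hs0 (by linarith) hr0 (by linarith)
  have l4 := hell (1 - s) (1 - r) hs1' (by linarith) hr1' (by linarith)
  have hkl : (s - r) ^ 2 / 4 ≤ s * (Real.log s - Real.log r)
      + (1 - s) * (Real.log (1 - s) - Real.log (1 - r)) := by
    nlinarith [sq_nonneg (s - r)]
  have hlogs : Real.log s = Real.log ρ - Real.log (ρ + v) := Real.log_div hρ.ne' (by positivity)
  have hlogr : Real.log r = Real.log ρ - Real.log (ρ + w) := Real.log_div hρ.ne' (by positivity)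
  have hlogs' : Real.log (1 - s) = Real.log v - Real.log (ρ + v) := by
    rw [hs1]; exact Real.log_div hv0.ne' (by positivity)
  have hlogr' : Real.log (1 - r) = Real.log w - Real.log (ρ + w) := by
    rw [hr1]; exact Real.log_div hw0.ne' (by positivity)
  rw [hlogs, hlogr, hlogs', hlogr', hs1] at hkl
  have hgap : ρ * (labTerm ρ v - labTerm ρ w) + v * (unlTerm ρ v - unlTerm ρ w)
      = (ρ + v) * (s * ((Real.log ρ - Real.log (ρ + v)) - (Real.log ρ - Real.log (ρ + w)))
        + v / (ρ + v) * ((Real.log v - Real.log (ρ + v)) - (Real.log w - Real.log (ρ + w)))) := by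
    rw [hs]
    unfold labTerm unlTerm
    field_simp
    ring
  rw [hgap]
  refine le_trans ?_ (mul_le_mul_of_nonneg_left hkl (by positivity))
  have hsr : (ρ + v) * ((s - r) ^ 2 / 4)
      = ρ ^ 2 / (4 * ((ρ + v) * (ρ + w) ^ 2)) * (v - w) ^ 2 := by
    rw [hs, hr]
    field_simp
    ring
  rw [hsr]
  refine mul_le_mul_of_nonneg_right ?_ (sq_nonneg _)
  have h5 : (ρ + v) * (ρ + w) ^ 2 ≤ (ρ + Real.exp B) * (ρ + Real.exp B) ^ 2 := by
    gcongr
    · exact hv.2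
    · exact hw.2
  have h6 : 0 < (ρ + v) * (ρ + w) ^ 2 := by positivity
  gcongr
  linarith

end Terms

/-! ### Concentration of the empirical criterion -/

section Hoeffding

variable {Ω : Type*} [MeasurableSpace Ω] {μ : Measure Ω} [IsProbabilityMeasure μ]

theorem measureReal_abs_sum_sub_ge_le {n : ℕ} {Y : Fin n → Ω → ℝ} {R ε : ℝ}
    (hind : iIndepFun Y μ) (hm : ∀ i, AEMeasurable (Y i) μ) (hb : ∀ i, ∀ᵐ ω ∂μ, |Y i ω| ≤ R)
    (hR : 0 ≤ R) (hε : 0 ≤ ε) :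
    μ.real {ω | ε ≤ |∑ i, Y i ω - ∑ i, ∫ ω, Y i ω ∂μ|}
      ≤ 2 * Real.exp (-ε ^ 2 / (2 * (n * R ^ 2))) := by
  have hsub : ∀ i, HasSubgaussianMGF (fun ω => Y i ω - ∫ ω, Y i ω ∂μ) ((‖R - -R‖₊ / 2) ^ 2) μ :=
    fun i => hasSubgaussianMGF_of_mem_Icc (hm i) ((hb i).mono fun ω h => abs_le.1 h)
  have hind' : iIndepFun (fun i ω => Y i ω - ∫ ω, Y i ω ∂μ) μ :=
    hind.comp (fun i y => y - ∫ ω, Y i ω ∂μ) fun i => measurable_id.sub_const _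
  have hindn : iIndepFun (fun i ω => -(Y i ω - ∫ ω, Y i ω ∂μ)) μ :=
    hind'.comp (fun i y => -y) fun i => measurable_neg
  have hc : ∑ _i : Fin n, (((‖R - -R‖₊ / 2) ^ 2 : NNReal) : ℝ) = n * R ^ 2 := by
    simp only [Finset.sum_const, Finset.card_univ, Fintype.card_fin, nsmul_eq_mul]
    congr 1
    simp only [NNReal.coe_pow, NNReal.coe_div, coe_nnnorm, Real.norm_eq_abs]
    rw [abs_of_nonneg (by linarith)]
    simp
  have h1 := HasSubgaussianMGF.measure_sum_ge_le_of_iIndepFun hind' (s := Finset.univ)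
    (fun i _ => hsub i) hε
  have h2 := HasSubgaussianMGF.measure_sum_ge_le_of_iIndepFun hindn (s := Finset.univ)
    (fun i _ => (hsub i).neg) hε
  rw [NNReal.coe_sum, hc] at h1 h2
  refine (measureReal_mono (μ := μ) (fun ω hω => ?_)).trans
    ((measureReal_union_le _ _).trans ((add_le_add h1 h2).trans (two_mul _).ge))
  simp only [Set.mem_ofPred_eq, Set.mem_union, Finset.sum_neg_distrib, Finset.sum_sub_distrib]
    at hω ⊢
  exact le_abs.1 hω

/-- Hoeffding's inequality for the sum of two independent samples. -/
theorem measureReal_two_sample_ge_le {E : Type*} [MeasurableSpace E] {n₀ n₁ : ℕ}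
    {X : Fin (n₀ + n₁) → Ω → E} {P Q : Measure E} (hind : iIndepFun X μ)
    (hP : ∀ i : Fin n₀, HasLaw (X (Fin.castAdd n₁ i)) P μ)
    (hQ : ∀ i : Fin n₁, HasLaw (X (Fin.natAdd n₀ i)) Q μ) {f g : E → ℝ} (hf : Measurable f)
    (hg : Measurable g) {R ε : ℝ} (hfR : ∀ᵐ x ∂P, |f x| ≤ R) (hgR : ∀ᵐ x ∂Q, |g x| ≤ R)
    (hR : 0 ≤ R) (hε : 0 ≤ ε) :
    μ.real {ω | ε ≤ |(∑ i : Fin n₀, f (X (Fin.castAdd n₁ i) ω) +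
        ∑ i : Fin n₁, g (X (Fin.natAdd n₀ i) ω)) - (n₀ * ∫ x, f x ∂P + n₁ * ∫ x, g x ∂Q)|}
      ≤ 2 * Real.exp (-ε ^ 2 / (2 * ((n₀ + n₁ : ℕ) * R ^ 2))) := by
  set F : Fin (n₀ + n₁) → E → ℝ := Fin.addCases (fun _ => f) (fun _ => g) with hF
  have hFl : ∀ i : Fin n₀, F (Fin.castAdd n₁ i) = f := fun i => by simp [hF]
  have hFr : ∀ i : Fin n₁, F (Fin.natAdd n₀ i) = g := fun i => by simp [hF]
  have hFm : ∀ i, Measurable (F i) := by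
    intro i
    induction i using Fin.addCases with
    | left i => rwa [hFl]
    | right i => rwa [hFr]
  have hXm : ∀ i, AEMeasurable (X i) μ := by
    intro i
    induction i using Fin.addCases with
    | left i => exact (hP i).aemeasurable
    | right i => exact (hQ i).aemeasurable
  have hb : ∀ i, ∀ᵐ ω ∂μ, |F i (X i ω)| ≤ R := by
    intro i
    induction i using Fin.addCases with
    | left i =>
      rw [hFl]
      have := (hP i).ae_iff (p := fun x => |f x| ≤ R) (measurableSet_setOfPred.1
        (measurableSet_le (by fun_prop) measurable_const))
      exact this.2 hfR
    | right i =>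
      rw [hFr]
      have := (hQ i).ae_iff (p := fun x => |g x| ≤ R) (measurableSet_setOfPred.1
        (measurableSet_le (by fun_prop) measurable_const))
      exact this.2 hgR
  have h := measureReal_abs_sum_sub_ge_le (μ := μ) (Y := fun i ω => F i (X i ω))
    (hind.comp F hFm) (fun i => (hFm i).comp_aemeasurable (hXm i)) hb hR hε
  have hIl : ∀ i : Fin n₀, ∫ ω, f (X (Fin.castAdd n₁ i) ω) ∂μ = ∫ x, f x ∂P := fun i =>
    (hP i).integral_comp hf.aestronglyMeasurable
  have hIr : ∀ i : Fin n₁, ∫ ω, g (X (Fin.natAdd n₀ i) ω) ∂μ = ∫ x, g x ∂Q := fun i =>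
    (hQ i).integral_comp hg.aestronglyMeasurable
  simpa only [Fin.sum_univ_add, hFl, hFr, hIl, hIr, Finset.sum_const, Finset.card_univ,
    Fintype.card_fin, nsmul_eq_mul] using h

end Hoeffding

/-- The population counterpart of the profile log-likelihood, per unlabeled observation and up to
a constant, as a functional of the odds `V`; `P` and `Q` are the laws of the labeled and the
unlabeled observations. -/
def risk {E : Type*} [MeasurableSpace E] (ρ : ℝ) (P Q : Measure E) (V : E → ℝ) : ℝ :=
  ρ * ∫ x, labTerm ρ (V x) ∂P + ∫ x, unlTerm ρ (V x) ∂Q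

/-- The empirical counterpart of `risk`, times the number of unlabeled observations. -/
def empSum {E : Type*} {n₀ n₁ : ℕ} (ρ : ℝ) (x : Fin (n₀ + n₁) → E) (V : E → ℝ) : ℝ :=
  ∑ i : Fin n₀, labTerm ρ (V (x (Fin.castAdd n₁ i))) +
    ∑ i : Fin n₁, unlTerm ρ (V (x (Fin.natAdd n₀ i)))

theorem abs_empSum_sub_le {E : Type*} {ρ B : ℝ} {n₀ n₁ : ℕ} (hρ : 0 < ρ) (hn : (n₀ : ℝ) = ρ * n₁)
    {x : Fin (n₀ + n₁) → E} {V W : E → ℝ} {η : ℝ} (hV : ∀ i, Real.exp (-B) ≤ V (x i))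
    (hW : ∀ i, Real.exp (-B) ≤ W (x i)) (h : ∀ i, |V (x i) - W (x i)| ≤ η) :
    |empSum ρ x V - empSum ρ x W| ≤ n₁ * ((1 + ρ) * (2 * Real.exp B * η)) := by
  have e : empSum ρ x V - empSum ρ x W =
      ∑ i : Fin n₀, (labTerm ρ (V (x (Fin.castAdd n₁ i))) - labTerm ρ (W (x (Fin.castAdd n₁ i)))) +
      ∑ i : Fin n₁,
        (unlTerm ρ (V (x (Fin.natAdd n₀ i))) - unlTerm ρ (W (x (Fin.natAdd n₀ i)))) := by
    unfold empSum
    rw [Finset.sum_sub_distrib, Finset.sum_sub_distrib]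
    ring
  have hle : ∀ i, 2 * Real.exp B * |V (x i) - W (x i)| ≤ 2 * Real.exp B * η := fun i =>
    mul_le_mul_of_nonneg_left (h i) (by positivity)
  rw [e]
  refine (abs_add_le _ _).trans ((add_le_add
    ((Finset.abs_sum_le_sum_abs _ _).trans (Finset.sum_le_sum fun i _ =>
      (abs_labTerm_sub_le hρ (hV _) (hW _)).trans (hle _)))
    ((Finset.abs_sum_le_sum_abs _ _).trans (Finset.sum_le_sum fun i _ =>
      (abs_unlTerm_sub_le hρ (hV _) (hW _)).trans (hle _)))).trans (le_of_eq ?_))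
  simp only [Finset.sum_const, Finset.card_univ, Fintype.card_fin, nsmul_eq_mul]
  rw [hn]
  ring

section Criterion

variable {E : Type*} [MeasurableSpace E] {ρ B : ℝ}
  {P Q : Measure E} [IsProbabilityMeasure P] [IsProbabilityMeasure Q] {V W : E → ℝ}

theorem integrable_labTerm (hρ : 0 < ρ) (hB : 0 ≤ B) (hV : Measurable V)
    (h : ∀ᵐ x ∂P, V x ∈ Set.Icc (Real.exp (-B)) (Real.exp B)) :
    Integrable (fun x => labTerm ρ (V x)) P :=
  Integrable.of_bound ((measurable_labTerm ρ).comp hV).aestronglyMeasurable (termBound ρ B)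
    (h.mono fun _ hx => abs_labTerm_le hρ hB hx)

theorem integrable_unlTerm (hρ : 0 < ρ) (hB : 0 ≤ B) (hV : Measurable V)
    (h : ∀ᵐ x ∂P, V x ∈ Set.Icc (Real.exp (-B)) (Real.exp B)) :
    Integrable (fun x => unlTerm ρ (V x)) P :=
  Integrable.of_bound ((measurable_unlTerm ρ).comp hV).aestronglyMeasurable (termBound ρ B)
    (h.mono fun _ hx => abs_unlTerm_le hρ hB hx)

theorem abs_risk_sub_le (hρ : 0 < ρ) (hB : 0 ≤ B) {η : ℝ} (hVm : Measurable V) (hWm : Measurable W)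
    (hVP : ∀ᵐ x ∂P, V x ∈ Set.Icc (Real.exp (-B)) (Real.exp B))
    (hWP : ∀ᵐ x ∂P, W x ∈ Set.Icc (Real.exp (-B)) (Real.exp B))
    (hVQ : ∀ᵐ x ∂Q, V x ∈ Set.Icc (Real.exp (-B)) (Real.exp B))
    (hWQ : ∀ᵐ x ∂Q, W x ∈ Set.Icc (Real.exp (-B)) (Real.exp B))
    (hP : ∀ᵐ x ∂P, |V x - W x| ≤ η) (hQ : ∀ᵐ x ∂Q, |V x - W x| ≤ η) :
    |risk ρ P Q V - risk ρ P Q W| ≤ (1 + ρ) * (2 * Real.exp B * η) := by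
  have e : risk ρ P Q V - risk ρ P Q W = ρ * ∫ x, (labTerm ρ (V x) - labTerm ρ (W x)) ∂P +
      ∫ x, (unlTerm ρ (V x) - unlTerm ρ (W x)) ∂Q := by
    rw [integral_sub (integrable_labTerm hρ hB hVm hVP) (integrable_labTerm hρ hB hWm hWP),
      integral_sub (integrable_unlTerm hρ hB hVm hVQ) (integrable_unlTerm hρ hB hWm hWQ)]
    unfold risk
    ring
  have h1 : |∫ x, (labTerm ρ (V x) - labTerm ρ (W x)) ∂P| ≤ 2 * Real.exp B * η := by
    have := norm_integral_le_of_norm_le_const (μ := P)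
      (f := fun x => labTerm ρ (V x) - labTerm ρ (W x)) (C := 2 * Real.exp B * η) (by
        filter_upwards [hVP, hWP, hP] with x h1 h2 h3
        exact (abs_labTerm_sub_le hρ h1.1 h2.1).trans
          (mul_le_mul_of_nonneg_left h3 (by positivity)))
    simpa using this
  have h2 : |∫ x, (unlTerm ρ (V x) - unlTerm ρ (W x)) ∂Q| ≤ 2 * Real.exp B * η := by
    have := norm_integral_le_of_norm_le_const (μ := Q)
      (f := fun x => unlTerm ρ (V x) - unlTerm ρ (W x)) (C := 2 * Real.exp B * η) (by
        filter_upwards [hVQ, hWQ, hQ] with x h1 h2 h3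
        exact (abs_unlTerm_sub_le hρ h1.1 h2.1).trans
          (mul_le_mul_of_nonneg_left h3 (by positivity)))
    simpa using this
  rw [e]
  refine (abs_add_le _ _).trans ?_
  rw [abs_mul, abs_of_pos hρ]
  nlinarith

end Criterion

/-- Uniform deviation over a finite set of parameters. -/
theorem measure_exists_deviation_le {Ω : Type*} [MeasurableSpace Ω] {μ : Measure Ω}
    [IsProbabilityMeasure μ] {E ι : Type*} [MeasurableSpace E] {n₀ n₁ : ℕ} {ρ B ε : ℝ}
    (hρ : 0 < ρ) (hB : 0 ≤ B) (hε : 0 ≤ ε) (hn₁ : 0 < n₁) (hn : (n₀ : ℝ) = ρ * n₁)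
    {X : Fin (n₀ + n₁) → Ω → E} {P Q : Measure E} (hind : iIndepFun X μ)
    (hP : ∀ i : Fin n₀, HasLaw (X (Fin.castAdd n₁ i)) P μ)
    (hQ : ∀ i : Fin n₁, HasLaw (X (Fin.natAdd n₀ i)) Q μ) (T : Finset ι) (V : ι → E → ℝ)
    (hV : ∀ θ ∈ T, Measurable (V θ))
    (hVP : ∀ θ ∈ T, ∀ᵐ x ∂P, V θ x ∈ Set.Icc (Real.exp (-B)) (Real.exp B))
    (hVQ : ∀ θ ∈ T, ∀ᵐ x ∂Q, V θ x ∈ Set.Icc (Real.exp (-B)) (Real.exp B)) :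
    μ {ω | ∃ θ ∈ T, n₁ * ε ≤ |empSum ρ (fun i => X i ω) (V θ) - n₁ * risk ρ P Q (V θ)|} ≤
      ENNReal.ofReal (T.card * (2 * Real.exp (-(ε ^ 2 / (2 * ((1 + ρ) * termBound ρ B) ^ 2)) *
        (n₀ + n₁ : ℕ)))) := by
  have hn₁' : (0 : ℝ) < n₁ := by exact_mod_cast hn₁
  have hR := termBound_pos hρ hB
  rw [← ofReal_measureReal]
  refine ENNReal.ofReal_le_ofReal ?_
  have e : {ω | ∃ θ ∈ T, n₁ * ε ≤ |empSum ρ (fun i => X i ω) (V θ) - n₁ * risk ρ P Q (V θ)|}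
      = ⋃ θ ∈ T, {ω | n₁ * ε ≤ |empSum ρ (fun i => X i ω) (V θ) - n₁ * risk ρ P Q (V θ)|} := by
    ext ω
    simp
  rw [e]
  refine (measureReal_biUnion_finset_le _ _).trans ?_
  refine (Finset.sum_le_sum fun θ hθ => ?_).trans_eq
    (by rw [Finset.sum_const, nsmul_eq_mul])
  have h := measureReal_two_sample_ge_le hind hP hQ (f := fun x => labTerm ρ (V θ x))
    (g := fun x => unlTerm ρ (V θ x)) ((measurable_labTerm ρ).comp (hV θ hθ))
    ((measurable_unlTerm ρ).comp (hV θ hθ))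
    ((hVP θ hθ).mono fun _ hx => abs_labTerm_le hρ hB hx)
    ((hVQ θ hθ).mono fun _ hx => abs_unlTerm_le hρ hB hx) hR.le
    (mul_nonneg hn₁'.le hε)
  have e1 : (n₁ : ℝ) * risk ρ P Q (V θ)
      = n₀ * ∫ x, labTerm ρ (V θ x) ∂P + n₁ * ∫ x, unlTerm ρ (V θ x) ∂Q := by
    rw [risk, hn]
    ring
  rw [e1]
  refine h.trans (le_of_eq ?_)
  congr 2
  push_cast
  rw [hn]
  field_simp
  ring

/-! ### Growth of the sieve -/

theorem isLittleO_knots {K n : ℕ → ℕ} (hK : Tendsto K atTop atTop)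
    (h : (fun t => (K t : ℝ) ^ (1 / 2 : ℝ) * Real.log (K t)) =o[atTop]
      fun t => Real.sqrt (n t : ℝ)) :
    (fun t => (K t : ℝ)) =o[atTop] fun t => (n t : ℝ) := by
  have h1 : (fun t => Real.sqrt (K t : ℝ)) =o[atTop] fun t => Real.sqrt (n t : ℝ) := by
    refine IsBigO.trans_isLittleO ?_ h
    refine IsBigO.of_bound 1 ?_
    filter_upwards [hK.eventually_ge_atTop 3] with t ht
    have h3 : (3 : ℝ) ≤ K t := by exact_mod_cast ht
    have hlog : 1 ≤ Real.log (K t) := by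
      rw [Real.le_log_iff_exp_le (by linarith)]
      linarith [Real.exp_one_lt_d9]
    rw [one_mul, ← Real.sqrt_eq_rpow, norm_mul, Real.norm_eq_abs, Real.norm_eq_abs,
      abs_of_nonneg (Real.sqrt_nonneg _), abs_of_nonneg (by linarith : 0 ≤ Real.log (K t))]
    exact le_mul_of_one_le_right (Real.sqrt_nonneg _) hlog
  have h2 := h1.mul h1
  simpa using h2

/-- A set whose size is exponential in `K`, with `K = o(n)`, is negligible against a probability
that is exponentially small in `n`. -/
theorem tendsto_card_mul_exp {K n : ℕ → ℕ} (hn : Tendsto n atTop atTop)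
    (hK : (fun t => (K t : ℝ)) =o[atTop] fun t => (n t : ℝ)) {κ : ℝ} (hκ : 0 < κ) (A p m : ℕ)
    (hA : 0 < A) :
    Tendsto (fun t => (A : ℝ) ^ (2 + p * (K t + m)) * (2 * Real.exp (-κ * n t))) atTop (𝓝 0) := by
  have hn' : Tendsto (fun t => (n t : ℝ)) atTop atTop := tendsto_natCast_atTop_atTop.comp hn
  have hA' : (1 : ℝ) ≤ A := by exact_mod_cast hA
  have hD : (fun t => Real.log A * (2 + p * (K t + m) : ℝ)) =o[atTop] fun t => (n t : ℝ) := by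
    refine IsLittleO.const_mul_left ?_ _
    have hconst : ∀ c : ℝ, (fun _ : ℕ => c) =o[atTop] fun t => (n t : ℝ) := fun c =>
      isLittleO_const_left.2 (Or.inr (tendsto_norm_atTop_atTop.comp hn'))
    exact (hconst 2).add ((hK.add (hconst m)).const_mul_left _)
  have hlim : Tendsto (fun t => 2 * Real.exp (-(κ / 2 * n t))) atTop (𝓝 0) := by
    have := (Real.tendsto_exp_neg_atTop_nhds_zero.comp
      (hn'.const_mul_atTop (half_pos hκ))).const_mul 2
    simpa using this
  refine squeeze_zero' (Eventually.of_forall fun t => by positivity) ?_ hlim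
  filter_upwards [hD.bound (half_pos hκ)] with t ht
  have hlogA : 0 ≤ Real.log A := Real.log_nonneg hA'
  rw [Real.norm_of_nonneg (by positivity), Real.norm_of_nonneg (by positivity)] at ht
  have e : (A : ℝ) ^ (2 + p * (K t + m)) = Real.exp (Real.log A * (2 + p * (K t + m) : ℝ)) := by
    rw [← Real.rpow_natCast, Real.rpow_def_of_pos (by linarith)]
    push_cast
    rfl
  rw [e, mul_left_comm, ← Real.exp_add]
  gcongr
  linarith

/-! ### The uniform distribution on the cube -/

/-- The uniform distribution on `[0,1]`. -/
def unitMeasure : Measure ℝ := volume.restrict (Set.Icc 0 1)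

instance : IsProbabilityMeasure unitMeasure := ⟨by simp [unitMeasure]⟩

/-- The uniform distribution on `[0,1]^p`, as a product measure. -/
def cubeMeasure (p : ℕ) : Measure (Fin p → ℝ) := Measure.pi fun _ => unitMeasure

instance (p : ℕ) : IsProbabilityMeasure (cubeMeasure p) := by
  unfold cubeMeasure; infer_instance

theorem cubeMeasure_eq (p : ℕ) :
    cubeMeasure p = volume.restrict (Set.Icc (0 : Fin p → ℝ) 1) := by
  rw [cubeMeasure, ← Set.pi_univ_Icc, volume_pi, Measure.restrict_pi_pi]
  rfl

theorem ae_mem_cube (p : ℕ) : ∀ᵐ x ∂cubeMeasure p, x ∈ Set.Icc (0 : Fin p → ℝ) 1 := by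
  rw [cubeMeasure_eq]
  exact ae_restrict_mem measurableSet_Icc

theorem ae_mem_Icc_unitMeasure : ∀ᵐ y ∂unitMeasure, y ∈ Set.Icc (0 : ℝ) 1 :=
  ae_restrict_mem measurableSet_Icc

theorem integral_unitMeasure (f : ℝ → ℝ) : ∫ y, f y ∂unitMeasure = ∫ y in (0 : ℝ)..1, f y := by
  rw [intervalIntegral.integral_of_le zero_le_one, unitMeasure, integral_Icc_eq_integral_Ioc]

theorem integral_cube_eval {p : ℕ} (j : Fin p) (f : ℝ → ℝ) (hf : Measurable f) :
    ∫ x, f (x j) ∂cubeMeasure p = ∫ y, f y ∂unitMeasure := by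
  have h := measurePreserving_eval (fun _ : Fin p => unitMeasure) j
  rw [← h.map_eq, integral_map h.measurable.aemeasurable (by fun_prop)]
  rfl

/-! ### Product functions have vanishing cross differences -/

theorem integral_cube_prod_mul_mul {p : ℕ} (F : Fin p → ℝ → ℝ) (j l : Fin p) (φ ψ : ℝ → ℝ) :
    ∫ x, (∏ i, F i (x i)) * (φ (x j) * ψ (x l)) ∂cubeMeasure p
      = ∏ i, ∫ y, F i y * ((if i = j then φ y else 1) * if i = l then ψ y else 1) ∂unitMeasure := by
  rw [cubeMeasure, ← integral_fintype_prod_eq_prod]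
  refine integral_congr_ae (ae_of_all _ fun x => ?_)
  simp only [Finset.prod_mul_distrib, Finset.prod_ite_eq', Finset.mem_univ, if_true]

/-- For a product function `w` and distinct coordinates `j`, `l`, the functional
`I(φ, ψ) = ∫ w φ(x_j) ψ(x_l)` has rank one: `I(1, 1) I(φ, ψ) = I(φ, 1) I(1, ψ)`. -/
theorem integral_cube_cross {p : ℕ} (F : Fin p → ℝ → ℝ) {j l : Fin p} (hjl : j ≠ l)
    (φ ψ : ℝ → ℝ) :
    (∫ x, ∏ i, F i (x i) ∂cubeMeasure p) *
        (∫ x, (∏ i, F i (x i)) * (φ (x j) * ψ (x l)) ∂cubeMeasure p)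
      = (∫ x, (∏ i, F i (x i)) * φ (x j) ∂cubeMeasure p) *
        (∫ x, (∏ i, F i (x i)) * ψ (x l) ∂cubeMeasure p) := by
  have h00 := integral_cube_prod_mul_mul F j l (fun _ => 1) fun _ => 1
  have h10 := integral_cube_prod_mul_mul F j l φ fun _ => 1
  have h01 := integral_cube_prod_mul_mul F j l (fun _ => 1) ψ
  simp only [mul_one, one_mul, ite_self] at h00 h10 h01
  rw [h00, h10, h01, integral_cube_prod_mul_mul, ← Finset.prod_mul_distrib,
    ← Finset.prod_mul_distrib]
  refine Finset.prod_congr rfl fun i _ => ?_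
  by_cases h1 : i = j
  · simp [h1, hjl]
    ring
  · simp [h1]

section Identification

variable {p : ℕ} {πlow M : ℝ} {q : Fin p → ℝ} {θ θ₀ : Param p}

theorem Param.unlOdds_sub_prop_eq (θ : Param p) (x : Fin p → ℝ) :
    θ.unlOdds x - θ.prop
      = (1 - θ.prop) * Real.exp (-θ.alpha) * ∏ i, Real.exp (-θ.comp i (x i)) := by
  rw [Param.unlOdds, Param.eta, ← Real.exp_sum, Finset.sum_neg_distrib, mul_assoc, ← Real.exp_add,
    neg_add]
  ring

theorem Param.integral_cross (θ : Param p) {j l : Fin p} (hjl : j ≠ l) (φ ψ : ℝ → ℝ) :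
    (∫ x, (θ.unlOdds x - θ.prop) ∂cubeMeasure p) *
        (∫ x, (θ.unlOdds x - θ.prop) * (φ (x j) * ψ (x l)) ∂cubeMeasure p)
      = (∫ x, (θ.unlOdds x - θ.prop) * φ (x j) ∂cubeMeasure p) *
        (∫ x, (θ.unlOdds x - θ.prop) * ψ (x l) ∂cubeMeasure p) := by
  simp_rw [Param.unlOdds_sub_prop_eq, mul_assoc ((1 - θ.prop) * Real.exp (-θ.alpha)),
    integral_const_mul]
  linear_combination ((1 - θ.prop) * Real.exp (-θ.alpha)) ^ 2 *
    integral_cube_cross (fun i y => Real.exp (-θ.comp i y)) hjl φ ψ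

/-- The function `exp(-u_j)` minus its mean: a test function that detects whether `u_j` is
constant. -/
def Param.testFun (θ : Param p) (j : Fin p) (y : ℝ) : ℝ :=
  Real.exp (-θ.comp j y) - ∫ z, Real.exp (-θ.comp j z) ∂unitMeasure

theorem Param.IsRegular.measurable_testFun (h : θ.IsRegular πlow M q) (j : Fin p) :
    Measurable (θ.testFun j) := by
  unfold Param.testFun
  have := h.measurable_comp j
  fun_prop

theorem Param.IsBounded.le_predBound (h : θ.IsBounded πlow M q) (j : Fin p) :
    q j ≤ predBound M q := by
  have h1 := Finset.single_le_sum (f := q)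
    (fun i _ => (abs_nonneg _).trans (h.abs_comp_le i 0 (by simp))) (Finset.mem_univ j)
  have h2 := (abs_nonneg _).trans h.abs_alpha_le
  unfold predBound
  linarith

theorem Param.IsBounded.exp_neg_comp_mem (h : θ.IsBounded πlow M q) (j : Fin p) {y : ℝ}
    (hy : y ∈ Set.Icc (0 : ℝ) 1) : Real.exp (-θ.comp j y) ∈ Set.Icc 0 (Real.exp (predBound M q)) :=
  ⟨(Real.exp_pos _).le, Real.exp_le_exp.2
    (by linarith [(abs_le.1 (h.abs_comp_le j y hy)).1, h.le_predBound j])⟩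

theorem Param.IsRegular.integrable_exp_neg_comp (h : θ.IsRegular πlow M q) (j : Fin p) :
    Integrable (fun y => Real.exp (-θ.comp j y)) unitMeasure := by
  have := h.measurable_comp j
  refine Integrable.of_mem_Icc 0 (Real.exp (predBound M q)) (by fun_prop) ?_
  exact ae_mem_Icc_unitMeasure.mono fun y hy => h.exp_neg_comp_mem j hy

theorem Param.IsRegular.abs_testFun_le (h : θ.IsRegular πlow M q) (j : Fin p) {y : ℝ}
    (hy : y ∈ Set.Icc (0 : ℝ) 1) : |θ.testFun j y| ≤ Real.exp (predBound M q) := by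
  have h1 := h.exp_neg_comp_mem j hy
  have h2 : ∫ z, Real.exp (-θ.comp j z) ∂unitMeasure ≤ Real.exp (predBound M q) := by
    have := integral_mono_ae (h.integrable_exp_neg_comp j)
      (integrable_const (μ := unitMeasure) (Real.exp (predBound M q)))
      (ae_mem_Icc_unitMeasure.mono fun y hy => (h.exp_neg_comp_mem j hy).2)
    simpa using this
  have h3 : 0 ≤ ∫ z, Real.exp (-θ.comp j z) ∂unitMeasure :=
    integral_nonneg fun _ => (Real.exp_pos _).le
  rw [Param.testFun, abs_le]
  constructor <;> linarith [h1.1, h1.2]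

theorem Param.IsRegular.integral_testFun (h : θ.IsRegular πlow M q) (j : Fin p) :
    ∫ y, θ.testFun j y ∂unitMeasure = 0 := by
  unfold Param.testFun
  rw [integral_sub (h.integrable_exp_neg_comp j) (integrable_const _)]
  simp

/-- The variance of `exp(-u_j)` is positive when `u_j` is continuous and not constant. -/
theorem Param.IsRegular.integral_mul_testFun_pos (h : θ.IsRegular πlow M q) (j : Fin p)
    (hc : ContinuousOn (θ.comp j) (Set.Icc 0 1))
    (hne : ¬ ∃ c, ∀ x ∈ Set.Icc (0 : ℝ) 1, θ.comp j x = c) :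
    0 < ∫ y, Real.exp (-θ.comp j y) * θ.testFun j y ∂unitMeasure := by
  set a := ∫ z, Real.exp (-θ.comp j z) ∂unitMeasure with ha
  have hm := h.measurable_comp j
  have hmt := h.measurable_testFun j
  have hbt : ∀ᵐ y ∂unitMeasure, ‖θ.testFun j y‖ ≤ Real.exp (predBound M q) :=
    ae_mem_Icc_unitMeasure.mono fun y hy => h.abs_testFun_le j hy
  have hti : Integrable (θ.testFun j) unitMeasure :=
    Integrable.of_bound hmt.aestronglyMeasurable _ hbt
  have ht2 : Integrable (fun y => θ.testFun j y ^ 2) unitMeasure := by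
    simp_rw [pow_two]
    exact hti.mul_of_top_left (memLp_top_of_bound hmt.aestronglyMeasurable _ hbt)
  have e : ∫ y, Real.exp (-θ.comp j y) * θ.testFun j y ∂unitMeasure
      = ∫ y, θ.testFun j y ^ 2 ∂unitMeasure := by
    have e1 : ∀ y, Real.exp (-θ.comp j y) * θ.testFun j y
        = θ.testFun j y ^ 2 + a * θ.testFun j y := by
      intro y
      simp only [Param.testFun, ← ha]
      ring
    simp_rw [e1]
    rw [integral_add ht2 (hti.const_mul a), integral_const_mul, h.integral_testFun]
    simp
  rw [e]
  refine lt_of_le_of_ne (integral_nonneg fun _ => sq_nonneg _) fun h0 => hne ?_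
  have h1 := (integral_eq_zero_iff_of_nonneg (fun _ => sq_nonneg _) ht2).1 h0.symm
  have h2 : (fun y => Real.exp (-θ.comp j y)) =ᵐ[volume.restrict (Set.Icc (0 : ℝ) 1)]
      fun _ => a := by
    filter_upwards [h1] with y hy
    have : θ.testFun j y = 0 := by simpa using hy
    simpa [Param.testFun, sub_eq_zero] using this
  have h3 := Measure.eqOn_Icc_of_ae_eq volume zero_ne_one h2
    (Real.continuous_exp.comp_continuousOn hc.neg) continuousOn_const
  refine ⟨-Real.log a, fun x hx => ?_⟩
  have h4 : Real.exp (-θ.comp j x) = a := h3 hx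
  rw [← h4, Real.log_exp, neg_neg]

/-- Identifiability: the interaction of the odds between two nonconstant components. -/
theorem Param.IsRegular.integral_interaction_pos (h : θ.IsRegular πlow M q) (hπ : 0 < πlow)
    {j l : Fin p} (hjl : j ≠ l) (hcj : ContinuousOn (θ.comp j) (Set.Icc 0 1))
    (hcl : ContinuousOn (θ.comp l) (Set.Icc 0 1))
    (hj : ¬ ∃ c, ∀ x ∈ Set.Icc (0 : ℝ) 1, θ.comp j x = c)
    (hl : ¬ ∃ c, ∀ x ∈ Set.Icc (0 : ℝ) 1, θ.comp l x = c) :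
    0 < ∫ x, (θ.unlOdds x - θ.prop) * (θ.testFun j (x j) * θ.testFun l (x l))
      ∂cubeMeasure p := by
  simp_rw [Param.unlOdds_sub_prop_eq, mul_assoc ((1 - θ.prop) * Real.exp (-θ.alpha))]
  rw [integral_const_mul, integral_cube_prod_mul_mul (fun i y => Real.exp (-θ.comp i y))]
  have h1 : 0 < 1 - θ.prop := by linarith [h.prop_lt_one hπ]
  refine mul_pos (mul_pos h1 (Real.exp_pos _)) (Finset.prod_pos fun i _ => ?_)
  by_cases hij : i = j
  · subst hij
    simpa [hjl] using h.integral_mul_testFun_pos i hcj hj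
  · by_cases hil : i = l
    · subst hil
      simpa [hij] using h.integral_mul_testFun_pos i hcl hl
    · simp only [hij, hil, if_false, mul_one]
      exact integral_exp_pos (h.integrable_exp_neg_comp i)

/-- If `X` and its perturbation `X + Δ e₁₁ + E` are two-by-two matrices of rank one, then `Δ` is
bounded by the perturbation `E`. -/
theorem abs_shift_le_of_cross {X11 X10 X01 κ E11 E10 E01 Ec Δ C D : ℝ} (hκ : 0 < κ)
    (hX : X11 * κ = X10 * X01) (hXE : (X11 + Δ + E11) * (κ + Ec) = (X10 + E10) * (X01 + E01))
    (hC : 0 ≤ C) (hD : D ≤ C) (hΔ : |Δ| ≤ 1) (h11 : |X11| ≤ C) (h10 : |X10| ≤ C)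
    (h01 : |X01| ≤ C) (hκC : κ ≤ C) (hE11 : |E11| ≤ C * D) (hE10 : |E10| ≤ C * D)
    (hE01 : |E01| ≤ C * D) (hEc : |Ec| ≤ C * D) :
    |Δ| ≤ C * (4 * C + 2 * C ^ 2 + 1) / κ * D := by
  have hCD : 0 ≤ C * D := (abs_nonneg _).trans hE11
  have e : Δ * κ = X10 * E01 + X01 * E10 + E10 * E01 - X11 * Ec - Δ * Ec - E11 * κ - E11 * Ec := by
    linear_combination hXE - hX
  have b : ∀ {a b A B : ℝ}, |a| ≤ A → |b| ≤ B → |a * b| ≤ A * B := fun {a b A B} ha hb => by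
    rw [abs_mul]
    exact mul_le_mul ha hb (abs_nonneg _) ((abs_nonneg _).trans ha)
  have hCDC : C * D ≤ C * C := mul_le_mul_of_nonneg_left hD hC
  have b1 := abs_le.1 (b h10 hE01)
  have b2 := abs_le.1 (b h01 hE10)
  have b3 := abs_le.1 (b (hE10.trans hCDC) hE01)
  have b4 := abs_le.1 (b h11 hEc)
  have b5 := abs_le.1 (b hΔ hEc)
  have b6 := abs_le.1 (b hE11 (show |κ| ≤ C by rwa [abs_of_pos hκ]))
  have b7 := abs_le.1 (b (hE11.trans hCDC) hEc)
  rw [div_mul_eq_mul_div, le_div_iff₀ hκ]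
  have : |Δ| * κ = |Δ * κ| := by rw [abs_mul, abs_of_pos hκ]
  rw [this, e, abs_le]
  constructor <;> linarith [b1.1, b1.2, b2.1, b2.2, b3.1, b3.2, b4.1, b4.2, b5.1, b5.2, b6.1, b6.2,
    b7.1, b7.2]

theorem Param.IsRegular.integrable_unlOdds (h : θ.IsRegular πlow M q) (hπ : 0 < πlow) :
    Integrable θ.unlOdds (cubeMeasure p) :=
  Integrable.of_mem_Icc _ _ h.measurable_unlOdds.aemeasurable
    ((ae_mem_cube p).mono fun _ hx => h.unlOdds_mem hπ hx)

theorem abs_integral_mul_le {E : Type*} [MeasurableSpace E] {P : Measure E} {f g : E → ℝ} {C : ℝ}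
    (hf : Integrable f P) (hg : ∀ᵐ x ∂P, |g x| ≤ C) :
    |∫ x, f x * g x ∂P| ≤ C * ∫ x, |f x| ∂P := by
  rw [← integral_const_mul]
  refine norm_integral_le_of_norm_le (f := fun x => f x * g x) (hf.abs.const_mul C) ?_
  filter_upwards [hg] with x hx
  rw [norm_mul, mul_comm]
  exact mul_le_mul_of_nonneg_right hx (abs_nonneg _)

/-- Identifiability of the mixture proportion, with a linear modulus. -/
theorem exists_abs_prop_sub_le (hπ : 0 < πlow) (h₀ : θ₀.IsRegular πlow M q) {j l : Fin p}
    (hjl : j ≠ l) (hcj : ContinuousOn (θ₀.comp j) (Set.Icc 0 1))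
    (hcl : ContinuousOn (θ₀.comp l) (Set.Icc 0 1))
    (hj : ¬ ∃ c, ∀ x ∈ Set.Icc (0 : ℝ) 1, θ₀.comp j x = c)
    (hl : ¬ ∃ c, ∀ x ∈ Set.Icc (0 : ℝ) 1, θ₀.comp l x = c) :
    ∃ C, 0 ≤ C ∧ ∀ θ : Param p, θ.IsRegular πlow M q →
      |θ₀.prop - θ.prop| ≤ C * ∫ x, |θ.unlOdds x - θ₀.unlOdds x| ∂cubeMeasure p := by
  set E := Real.exp (predBound M q) with hE
  have hE1 : 1 ≤ E := Real.one_le_exp h₀.predBound_nonneg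
  have hE2 : E ≤ E ^ 3 := le_self_pow₀ hE1 (by norm_num)
  have hE3 : E ^ 2 ≤ E ^ 3 := pow_le_pow_right₀ hE1 (by norm_num)
  set φ := θ₀.testFun j with hφ
  set ψ := θ₀.testFun l with hψ
  set κ := ∫ x, (θ₀.unlOdds x - θ₀.prop) * (φ (x j) * ψ (x l)) ∂cubeMeasure p
  have hκ : 0 < κ := h₀.integral_interaction_pos hπ hjl hcj hcl hj hl
  refine ⟨E ^ 3 * (4 * E ^ 3 + 2 * (E ^ 3) ^ 2 + 1) / κ, by positivity, fun θ h => ?_⟩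
  have hφm : Measurable fun x : Fin p → ℝ => φ (x j) :=
    (h₀.measurable_testFun j).comp (measurable_pi_apply j)
  have hψm : Measurable fun x : Fin p → ℝ => ψ (x l) :=
    (h₀.measurable_testFun l).comp (measurable_pi_apply l)
  have hφb : ∀ᵐ x ∂cubeMeasure p, |φ (x j)| ≤ E :=
    (ae_mem_cube p).mono fun x hx => h₀.abs_testFun_le j (apply_mem_Icc hx j)
  have hψb : ∀ᵐ x ∂cubeMeasure p, |ψ (x l)| ≤ E :=
    (ae_mem_cube p).mono fun x hx => h₀.abs_testFun_le l (apply_mem_Icc hx l)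
  have hφψb : ∀ᵐ x ∂cubeMeasure p, |φ (x j) * ψ (x l)| ≤ E ^ 2 := by
    filter_upwards [hφb, hψb] with x h1 h2
    rw [abs_mul, pow_two]
    exact mul_le_mul h1 h2 (abs_nonneg _) (by positivity)
  have hVi := h.integrable_unlOdds hπ
  have hV₀i := h₀.integrable_unlOdds hπ
  have hWi : Integrable (fun x => θ₀.unlOdds x - θ₀.prop) (cubeMeasure p) :=
    hV₀i.sub (integrable_const _)
  have hei : Integrable (fun x => θ.unlOdds x - θ₀.unlOdds x) (cubeMeasure p) := hVi.sub hV₀i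
  set D := ∫ x, |θ.unlOdds x - θ₀.unlOdds x| ∂cubeMeasure p with hD
  have hD0 : 0 ≤ D := integral_nonneg fun _ => abs_nonneg _
  -- `θ.unlOdds - θ.prop` is `θ₀.unlOdds - θ₀.prop` plus a constant plus the difference of the odds
  have hexp : ∀ (ζ : (Fin p → ℝ) → ℝ) (C : ℝ), Measurable ζ →
      (∀ᵐ x ∂cubeMeasure p, |ζ x| ≤ C) →
      ∫ x, (θ.unlOdds x - θ.prop) * ζ x ∂cubeMeasure p =
        ∫ x, (θ₀.unlOdds x - θ₀.prop) * ζ x ∂cubeMeasure p +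
        (θ₀.prop - θ.prop) * ∫ x, ζ x ∂cubeMeasure p +
        ∫ x, (θ.unlOdds x - θ₀.unlOdds x) * ζ x ∂cubeMeasure p := by
    intro ζ C hζ hζC
    have hζi : Integrable ζ (cubeMeasure p) :=
      Integrable.of_bound hζ.aestronglyMeasurable C hζC
    have hζt := memLp_top_of_bound hζ.aestronglyMeasurable C hζC
    have i1 : Integrable (fun x => (θ₀.unlOdds x - θ₀.prop) * ζ x) (cubeMeasure p) :=
      hWi.mul_of_top_left hζt
    have i2 : Integrable (fun x => (θ.unlOdds x - θ₀.unlOdds x) * ζ x) (cubeMeasure p) :=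
      hei.mul_of_top_left hζt
    have i3 : Integrable (fun x => (θ₀.prop - θ.prop) * ζ x) (cubeMeasure p) := hζi.const_mul _
    have i13 : Integrable (fun x => (θ₀.unlOdds x - θ₀.prop) * ζ x + (θ₀.prop - θ.prop) * ζ x)
        (cubeMeasure p) := i1.add i3
    rw [← integral_const_mul, ← integral_add i1 i3, ← integral_add i13 i2]
    refine integral_congr_ae (ae_of_all _ fun x => ?_)
    dsimp only
    ring
  have x11 := hexp (fun _ => 1) 1 measurable_const (by simp)
  have x10 := hexp _ E hφm hφb
  have x01 := hexp _ E hψm hψb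
  have xc := hexp (fun x => φ (x j) * ψ (x l)) (E ^ 2) (hφm.mul hψm) hφψb
  have m10 : ∫ x, φ (x j) ∂cubeMeasure p = 0 := by
    rw [integral_cube_eval j φ (h₀.measurable_testFun j), h₀.integral_testFun j]
  have m01 : ∫ x, ψ (x l) ∂cubeMeasure p = 0 := by
    rw [integral_cube_eval l ψ (h₀.measurable_testFun l), h₀.integral_testFun l]
  have mc : ∫ x, φ (x j) * ψ (x l) ∂cubeMeasure p = 0 := by
    have := integral_cube_cross (fun _ _ => 1) hjl φ ψ
    simpa [m10] using this
  have cr := θ.integral_cross hjl φ ψ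
  have cr₀ := θ₀.integral_cross hjl φ ψ
  simp only [mul_one, integral_const, probReal_univ, smul_eq_mul] at x11
  rw [m10, mul_zero, add_zero] at x10
  rw [m01, mul_zero, add_zero] at x01
  rw [mc, mul_zero, add_zero] at xc
  rw [x11, x10, x01, xc] at cr
  have hWabs : ∫ x, |θ₀.unlOdds x - θ₀.prop| ∂cubeMeasure p ≤ E := by
    have := integral_mono_ae hWi.abs (integrable_const (μ := cubeMeasure p) E) (by
      filter_upwards [ae_mem_cube p] with x hx
      have h1 := (h₀.unlOdds_mem hπ hx)
      have h2 : 0 ≤ θ₀.unlOdds x - θ₀.prop := by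
        rw [Param.unlOdds_sub_prop_eq]
        have := h₀.prop_lt_one hπ
        have : 0 < 1 - θ₀.prop := by linarith
        positivity
      rw [abs_of_nonneg h2]
      linarith [h1.2, h₀.prop_pos hπ])
    simpa using this
  have hDE : D ≤ E := by
    have := integral_mono_ae hei.abs (integrable_const (μ := cubeMeasure p) E) (by
      filter_upwards [ae_mem_cube p] with x hx
      have h1 := h₀.unlOdds_mem hπ hx
      have h2 := h.unlOdds_mem hπ hx
      have h3 := Real.exp_pos (-predBound M q)
      rw [abs_le]
      constructor <;> linarith [h1.1, h1.2, h2.1, h2.2])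
    simpa using this
  have bE : E * E ≤ E ^ 3 := by rw [← pow_two]; exact hE3
  have bE' : E ^ 2 * E = E ^ 3 := by ring
  refine abs_shift_le_of_cross hκ cr₀ cr (by positivity) (hDE.trans hE2) ?_ ?_ ?_ ?_ ?_ ?_ ?_ ?_ ?_
  · have h1 := h.prop_pos hπ
    have h2 := h.prop_lt_one hπ
    have h3 := h₀.prop_pos hπ
    have h4 := h₀.prop_lt_one hπ
    rw [abs_le]
    constructor <;> linarith
  · exact (abs_integral_le_integral_abs).trans (hWabs.trans hE2)
  · exact (abs_integral_mul_le hWi hφb).trans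
      ((mul_le_mul_of_nonneg_left hWabs (by positivity)).trans bE)
  · exact (abs_integral_mul_le hWi hψb).trans
      ((mul_le_mul_of_nonneg_left hWabs (by positivity)).trans bE)
  · exact (le_abs_self _).trans ((abs_integral_mul_le hWi hφψb).trans
      ((mul_le_mul_of_nonneg_left hWabs (by positivity)).trans bE'.le))
  · exact (abs_integral_le_integral_abs).trans
      (le_mul_of_one_le_left hD0 (hE1.trans hE2))
  · exact (abs_integral_mul_le hei hφb).trans (mul_le_mul_of_nonneg_right hE2 hD0)
  · exact (abs_integral_mul_le hei hψb).trans (mul_le_mul_of_nonneg_right hE2 hD0)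
  · exact (abs_integral_mul_le hei hφψb).trans (mul_le_mul_of_nonneg_right hE3 hD0)

theorem Param.IsRegular.integrable_eta (h : θ.IsRegular πlow M q) :
    Integrable θ.eta (cubeMeasure p) :=
  Integrable.of_bound h.measurable_eta.aestronglyMeasurable (∑ j, q j)
    ((ae_mem_cube p).mono fun _ hx => h.abs_eta_le hx)

theorem Param.IsRegular.integral_eta (h : θ.IsRegular πlow M q) :
    ∫ x, θ.eta x ∂cubeMeasure p = 0 := by
  unfold Param.eta
  rw [integral_finsetSum]
  · refine Finset.sum_eq_zero fun j _ => ?_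
    rw [integral_cube_eval j _ (h.measurable_comp j), integral_unitMeasure, h.integral_comp]
  · intro j _
    exact Integrable.of_bound
      ((h.measurable_comp j).comp (measurable_pi_apply j)).aestronglyMeasurable (q j)
      ((ae_mem_cube p).mono fun x hx => h.abs_comp_le j _ (apply_mem_Icc hx j))

/-- Identifiability of the whole parameter, with a linear modulus in the `L₁` distance of the
odds. -/
theorem exists_identification (hπ : 0 < πlow) (h₀ : θ₀.IsRegular πlow M q)
    (hc : ∀ j, ContinuousOn (θ₀.comp j) (Set.Icc 0 1))
    (hid : ∃ j l, j ≠ l ∧ (¬ ∃ c, ∀ x ∈ Set.Icc (0 : ℝ) 1, θ₀.comp j x = c) ∧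
      ¬ ∃ c, ∀ x ∈ Set.Icc (0 : ℝ) 1, θ₀.comp l x = c) :
    ∃ C, 0 ≤ C ∧ ∀ θ : Param p, θ.IsRegular πlow M q →
      |θ.prop - θ₀.prop| ≤ C * ∫ x, |θ.unlOdds x - θ₀.unlOdds x| ∂cubeMeasure p ∧
      |θ.alpha - θ₀.alpha| ≤ C * ∫ x, |θ.unlOdds x - θ₀.unlOdds x| ∂cubeMeasure p ∧
      ∫ x, (θ.eta x - θ₀.eta x) ^ 2 ∂cubeMeasure p
        ≤ C * ∫ x, |θ.unlOdds x - θ₀.unlOdds x| ∂cubeMeasure p := by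
  obtain ⟨j, l, hjl, hj, hl⟩ := hid
  obtain ⟨C₁, hC₁, hprop⟩ := exists_abs_prop_sub_le hπ h₀ hjl (hc j) (hc l) hj hl
  set B := predBound M q with hB
  have hB0 : 0 ≤ B := h₀.predBound_nonneg
  set E := Real.exp B with hE
  have hE1 : 1 ≤ E := Real.one_le_exp hB0
  set C₂ := E / πlow * (1 + E * C₁) with hC₂
  have hC₂0 : 0 ≤ C₂ := by positivity
  refine ⟨C₁ + C₂ + 2 * B * (2 * C₂), by positivity, fun θ h => ?_⟩
  set D := ∫ x, |θ.unlOdds x - θ₀.unlOdds x| ∂cubeMeasure p with hD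
  have hD0 : 0 ≤ D := integral_nonneg fun _ => abs_nonneg _
  have hΔ := hprop θ h
  rw [← hD] at hΔ
  have hei : Integrable (fun x => θ.unlOdds x - θ₀.unlOdds x) (cubeMeasure p) :=
    (h.integrable_unlOdds hπ).sub (h₀.integrable_unlOdds hπ)
  have hpt : ∀ᵐ x ∂cubeMeasure p, |(θ.alpha + θ.eta x) - (θ₀.alpha + θ₀.eta x)|
      ≤ E / πlow * (|θ.unlOdds x - θ₀.unlOdds x| + E * |θ₀.prop - θ.prop|) := by
    filter_upwards [ae_mem_cube p] with x hx
    obtain ⟨g1, g2⟩ := h.exp_neg_pred_mem hx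
    obtain ⟨g3, g4⟩ := h₀.exp_neg_pred_mem hx
    have hlog := abs_log_sub_log_le (Real.exp_pos _) g3 g1
    rw [Real.log_exp, Real.log_exp, Real.exp_neg (predBound M q), inv_inv, ← hB, ← hE] at hlog
    have hneg : -(θ₀.alpha + θ₀.eta x) - -(θ.alpha + θ.eta x)
        = (θ.alpha + θ.eta x) - (θ₀.alpha + θ₀.eta x) := by ring
    rw [hneg] at hlog
    refine hlog.trans ?_
    rw [div_mul_eq_mul_div, mul_div_assoc]
    refine mul_le_mul_of_nonneg_left ?_ (by positivity)
    rw [le_div_iff₀ hπ]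
    have hV : θ.unlOdds x = θ.prop + (1 - θ.prop) * Real.exp (-(θ.alpha + θ.eta x)) := rfl
    have hV₀ : θ₀.unlOdds x = θ₀.prop + (1 - θ₀.prop) * Real.exp (-(θ₀.alpha + θ₀.eta x)) := rfl
    set G := Real.exp (-(θ.alpha + θ.eta x))
    set G₀ := Real.exp (-(θ₀.alpha + θ₀.eta x)) with hG₀
    have hG₀pos : 0 < G₀ := Real.exp_pos _
    have hrel : (G₀ - G) * (1 - θ.prop)
        = -((θ.unlOdds x - θ₀.unlOdds x) + (1 - G₀) * (θ₀.prop - θ.prop)) := by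
      rw [hV, hV₀]
      ring
    have h1 : πlow ≤ 1 - θ.prop := by linarith [h.prop_mem.2]
    have h2 : |1 - G₀| ≤ E := by
      rw [abs_le]
      constructor <;> linarith
    calc |G₀ - G| * πlow ≤ |G₀ - G| * (1 - θ.prop) :=
          mul_le_mul_of_nonneg_left h1 (abs_nonneg _)
      _ = |(G₀ - G) * (1 - θ.prop)| := by rw [abs_mul, abs_of_pos (hπ.trans_le h1)]
      _ ≤ |θ.unlOdds x - θ₀.unlOdds x| + |1 - G₀| * |θ₀.prop - θ.prop| := by
          rw [hrel, abs_neg, ← abs_mul]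
          exact abs_add_le _ _
      _ ≤ _ := by gcongr
  have hηi : Integrable (fun x => θ.eta x - θ₀.eta x) (cubeMeasure p) :=
    h.integrable_eta.sub h₀.integrable_eta
  have hβi : Integrable (fun x => (θ.alpha + θ.eta x) - (θ₀.alpha + θ₀.eta x)) (cubeMeasure p) :=
    (((integrable_const _).add h.integrable_eta).sub
      ((integrable_const _).add h₀.integrable_eta))
  have hβ1 : ∫ x, |(θ.alpha + θ.eta x) - (θ₀.alpha + θ₀.eta x)| ∂cubeMeasure p ≤ C₂ * D := by
    refine (integral_mono_ae hβi.abs ((hei.abs.add (integrable_const _)).const_mul _) hpt).trans ?_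
    rw [integral_const_mul]
    simp only [Pi.add_apply]
    rw [integral_add hei.abs (integrable_const _), ← hD]
    simp only [integral_const, probReal_univ, smul_eq_mul, one_mul]
    rw [hC₂, mul_assoc]
    refine mul_le_mul_of_nonneg_left ?_ (by positivity)
    nlinarith
  have hα : |θ.alpha - θ₀.alpha| ≤ C₂ * D := by
    have e : θ.alpha - θ₀.alpha
        = ∫ x, ((θ.alpha + θ.eta x) - (θ₀.alpha + θ₀.eta x)) ∂cubeMeasure p := by
      simp_rw [add_sub_add_comm]
      rw [integral_add (integrable_const _) hηi, integral_sub h.integrable_eta h₀.integrable_eta,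
        h.integral_eta, h₀.integral_eta]
      simp
    rw [e]
    exact abs_integral_le_integral_abs.trans hβ1
  have hη : ∫ x, (θ.eta x - θ₀.eta x) ^ 2 ∂cubeMeasure p ≤ 2 * B * (2 * C₂ * D) := by
    have hpt2 : ∀ᵐ x ∂cubeMeasure p, (θ.eta x - θ₀.eta x) ^ 2 ≤ 2 * B *
        (|(θ.alpha + θ.eta x) - (θ₀.alpha + θ₀.eta x)| + |θ.alpha - θ₀.alpha|) := by
      filter_upwards [ae_mem_cube p] with x hx
      have h1 := h.abs_eta_le hx
      have h2 := h₀.abs_eta_le hx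
      have h3 : ∑ j, q j ≤ B := by
        have := (abs_nonneg _).trans h₀.abs_alpha_le
        rw [hB, predBound]
        linarith
      have h4 : |θ.eta x - θ₀.eta x| ≤ 2 * B := (abs_sub _ _).trans (by linarith)
      have h5 : |θ.eta x - θ₀.eta x|
          ≤ |(θ.alpha + θ.eta x) - (θ₀.alpha + θ₀.eta x)| + |θ.alpha - θ₀.alpha| := by
        have := abs_sub ((θ.alpha + θ.eta x) - (θ₀.alpha + θ₀.eta x)) (θ.alpha - θ₀.alpha)
        rwa [show (θ.alpha + θ.eta x) - (θ₀.alpha + θ₀.eta x) - (θ.alpha - θ₀.alpha)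
          = θ.eta x - θ₀.eta x by ring] at this
      rw [← sq_abs, pow_two]
      exact mul_le_mul h4 h5 (abs_nonneg _) (by positivity)
    have hint : Integrable (fun x => (θ.eta x - θ₀.eta x) ^ 2) (cubeMeasure p) := by
      refine Integrable.mono'
        ((hβi.abs.add (integrable_const |θ.alpha - θ₀.alpha|)).const_mul (2 * B))
        ((h.measurable_eta.sub h₀.measurable_eta).pow_const 2).aestronglyMeasurable ?_
      filter_upwards [hpt2] with x hx
      rwa [Real.norm_of_nonneg (sq_nonneg _)]
    refine (integral_mono_ae hint ((hβi.abs.add (integrable_const _)).const_mul _) hpt2).trans ?_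
    rw [integral_const_mul]
    simp only [Pi.add_apply]
    rw [integral_add hβi.abs (integrable_const _)]
    simp only [integral_const, probReal_univ, smul_eq_mul, one_mul]
    refine mul_le_mul_of_nonneg_left ?_ (by positivity)
    linarith
  have n1 : 0 ≤ C₁ * D := by positivity
  have n2 : 0 ≤ C₂ * D := by positivity
  have n3 : 0 ≤ 2 * B * (2 * C₂ * D) := by positivity
  refine ⟨?_, ?_, ?_⟩
  · rw [abs_sub_comm]
    linarith
  · linarith
  · linarith

end Identification

/-! ### The laws of the observations -/

/-- A probability density on the unit cube, bounded there between `C₀⁻¹` and `C₀`. -/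
structure IsCubeDensity {p : ℕ} (C₀ : ℝ) (h : (Fin p → ℝ) → ℝ) : Prop where
  measurable : Measurable h
  integral_eq_one : ∫ x, h x = 1
  eq_zero : ∀ x, x ∉ Set.Icc (0 : Fin p → ℝ) 1 → h x = 0
  const_pos : 0 < C₀
  bdd : ∀ x ∈ Set.Icc (0 : Fin p → ℝ) 1, C₀⁻¹ ≤ h x ∧ h x ≤ C₀

theorem law_eq_withDensity_cube {p : ℕ} {f : (Fin p → ℝ) → ℝ}
    (hf : ∀ x, x ∉ Set.Icc (0 : Fin p → ℝ) 1 → f x = 0) :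
    law f = (cubeMeasure p).withDensity fun x => ENNReal.ofReal (f x) := by
  rw [cubeMeasure_eq, ← withDensity_indicator measurableSet_Icc, law]
  congr 1
  ext x
  by_cases hx : x ∈ Set.Icc (0 : Fin p → ℝ) 1
  · rw [Set.indicator_of_mem hx]
  · rw [Set.indicator_of_notMem hx, hf x hx, ENNReal.ofReal_zero]

theorem ae_law_mem_cube {p : ℕ} {f : (Fin p → ℝ) → ℝ}
    (hf : ∀ x, x ∉ Set.Icc (0 : Fin p → ℝ) 1 → f x = 0) :
    ∀ᵐ x ∂law f, x ∈ Set.Icc (0 : Fin p → ℝ) 1 := by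
  rw [law_eq_withDensity_cube hf]
  exact (withDensity_absolutelyContinuous _ _).ae_le (ae_mem_cube p)

theorem integral_law {p : ℕ} {f : (Fin p → ℝ) → ℝ} (hfm : Measurable f) (hf0 : ∀ x, 0 ≤ f x)
    (hf : ∀ x, x ∉ Set.Icc (0 : Fin p → ℝ) 1 → f x = 0) (g : (Fin p → ℝ) → ℝ) :
    ∫ x, g x ∂law f = ∫ x, f x * g x ∂cubeMeasure p := by
  rw [law_eq_withDensity_cube hf,
    integral_withDensity_eq_integral_toReal_smul (by fun_prop) (by simp)]
  simp_rw [ENNReal.toReal_ofReal (hf0 _), smul_eq_mul]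

theorem isProbabilityMeasure_law {p : ℕ} {f : (Fin p → ℝ) → ℝ} (hf0 : ∀ x, 0 ≤ f x)
    (hf1 : ∫ x, f x = 1) : IsProbabilityMeasure (law f) := by
  have hi : Integrable f := by
    by_contra h
    rw [integral_undef h] at hf1
    exact zero_ne_one hf1
  refine ⟨?_⟩
  rw [law, withDensity_apply _ MeasurableSet.univ, Measure.restrict_univ,
    ← ofReal_integral_eq_lintegral_ofReal hi (ae_of_all _ hf0), hf1, ENNReal.ofReal_one]

section Laws

variable {p : ℕ} {πlow M C₀ ρ : ℝ} {q : Fin p → ℝ} {θ θ₀ : Param p} {h : (Fin p → ℝ) → ℝ}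

theorem IsCubeDensity.nonneg (hh : IsCubeDensity C₀ h) (x : Fin p → ℝ) : 0 ≤ h x := by
  by_cases hx : x ∈ Set.Icc (0 : Fin p → ℝ) 1
  · exact (inv_nonneg.2 hh.const_pos.le).trans (hh.bdd x hx).1
  · exact (hh.eq_zero x hx).ge

theorem IsCubeDensity.posDensity_eq_zero (hh : IsCubeDensity C₀ h) (θ : Param p) :
    ∀ x, x ∉ Set.Icc (0 : Fin p → ℝ) 1 → θ.posDensity h x = 0 := fun x hx => by
  rw [Param.posDensity, hh.eq_zero x hx, mul_zero]

theorem IsCubeDensity.posDensity_nonneg (hh : IsCubeDensity C₀ h) (θ : Param p) (x : Fin p → ℝ) :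
    0 ≤ θ.posDensity h x :=
  mul_nonneg (Real.exp_pos _).le (hh.nonneg x)

/-- The density of the unlabeled data is the positive density times the odds. -/
theorem Param.unlDensity_eq (θ : Param p) (h : (Fin p → ℝ) → ℝ) (x : Fin p → ℝ) :
    θ.unlDensity h x = θ.posDensity h x * θ.unlOdds x := by
  have : Real.exp (θ.alpha + θ.eta x) * Real.exp (-(θ.alpha + θ.eta x)) = 1 := by
    rw [← Real.exp_add, add_neg_cancel, Real.exp_zero]
  rw [Param.unlDensity, Param.posDensity, Param.unlOdds]
  linear_combination -((1 - θ.prop) * h x) * this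

theorem IsCubeDensity.unlDensity_eq_zero (hh : IsCubeDensity C₀ h) (θ : Param p) :
    ∀ x, x ∉ Set.Icc (0 : Fin p → ℝ) 1 → θ.unlDensity h x = 0 := fun x hx => by
  rw [Param.unlDensity_eq, hh.posDensity_eq_zero θ x hx, zero_mul]

theorem IsCubeDensity.unlDensity_nonneg (hh : IsCubeDensity C₀ h) (hθ : θ.IsBounded πlow M q)
    (hπ : 0 < πlow) (x : Fin p → ℝ) : 0 ≤ θ.unlDensity h x := by
  have h1 : 0 ≤ 1 - θ.prop := by linarith [hθ.prop_lt_one hπ]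
  exact add_nonneg (mul_nonneg (hθ.prop_pos hπ).le (hh.posDensity_nonneg θ x))
    (mul_nonneg h1 (hh.nonneg x))

theorem IsCubeDensity.integral_unlDensity (hh : IsCubeDensity C₀ h)
    (hg : ∫ x, θ.posDensity h x = 1) : ∫ x, θ.unlDensity h x = 1 := by
  have hi : ∀ f : (Fin p → ℝ) → ℝ, ∫ x, f x = 1 → Integrable f := fun f hf => by
    by_contra hn
    rw [integral_undef hn] at hf
    exact zero_ne_one hf
  unfold Param.unlDensity
  rw [integral_add ((hi _ hg).const_mul _) ((hi _ hh.integral_eq_one).const_mul _),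
    integral_const_mul, integral_const_mul, hg, hh.integral_eq_one]
  ring

theorem IsCubeDensity.measurable_posDensity (hh : IsCubeDensity C₀ h)
    (hθ : θ.IsRegular πlow M q) : Measurable (θ.posDensity h) := by
  unfold Param.posDensity
  have := hθ.measurable_eta
  have := hh.measurable
  fun_prop

theorem IsCubeDensity.measurable_unlDensity (hh : IsCubeDensity C₀ h)
    (hθ : θ.IsRegular πlow M q) : Measurable (θ.unlDensity h) := by
  unfold Param.unlDensity
  have := hh.measurable_posDensity hθ
  have := hh.measurable
  fun_prop

theorem IsCubeDensity.posDensity_mem (hh : IsCubeDensity C₀ h) (hθ : θ.IsBounded πlow M q)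
    {x : Fin p → ℝ} (hx : x ∈ Set.Icc (0 : Fin p → ℝ) 1) : θ.posDensity h x ∈
      Set.Icc (Real.exp (-predBound M q) * C₀⁻¹) (Real.exp (predBound M q) * C₀) := by
  have h1 := abs_le.1 (hθ.abs_pred_le hx)
  have h2 := hh.bdd x hx
  have h3 := hh.const_pos
  constructor
  · exact mul_le_mul (Real.exp_le_exp.2 (by linarith)) h2.1 (by positivity) (Real.exp_pos _).le
  · exact mul_le_mul (Real.exp_le_exp.2 (by linarith)) h2.2 (hh.nonneg x) (Real.exp_pos _).le

theorem integrable_sq_unlOdds_sub (hπ : 0 < πlow) (h₀ : θ₀.IsRegular πlow M q)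
    (hθ : θ.IsRegular πlow M q) :
    Integrable (fun x => (θ.unlOdds x - θ₀.unlOdds x) ^ 2) (cubeMeasure p) := by
  have h1 := h₀.measurable_unlOdds
  have h2 := hθ.measurable_unlOdds
  refine Integrable.of_bound (by fun_prop) (Real.exp (predBound M q) ^ 2) ?_
  filter_upwards [ae_mem_cube p] with x hx
  have h1 := h₀.unlOdds_mem hπ hx
  have h2 := hθ.unlOdds_mem hπ hx
  have h3 := Real.exp_pos (-predBound M q)
  rw [Real.norm_of_nonneg (sq_nonneg _)]
  refine sq_le_sq' ?_ ?_ <;> linarith [h1.1, h1.2, h2.1, h2.2]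

/-- The true odds maximize the population criterion, with a quadratic margin in `L₂`. -/
theorem sq_dist_le_risk_gap (hρ : 0 < ρ) (hπ : 0 < πlow) (hh : IsCubeDensity C₀ h)
    (hg : ∫ x, θ₀.posDensity h x = 1) (h₀ : θ₀.IsRegular πlow M q) (hθ : θ.IsRegular πlow M q) :
    Real.exp (-predBound M q) * C₀⁻¹ * (ρ ^ 2 / (4 * (ρ + Real.exp (predBound M q)) ^ 3)) *
        ∫ x, (θ.unlOdds x - θ₀.unlOdds x) ^ 2 ∂cubeMeasure p
      ≤ risk ρ (law (θ₀.posDensity h)) (law (θ₀.unlDensity h)) θ₀.unlOdds -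
        risk ρ (law (θ₀.posDensity h)) (law (θ₀.unlDensity h)) θ.unlOdds := by
  set B := predBound M q with hB
  have hB0 : 0 ≤ B := h₀.predBound_nonneg
  have hC₀ := hh.const_pos
  have hPp : IsProbabilityMeasure (law (θ₀.posDensity h)) :=
    isProbabilityMeasure_law (hh.posDensity_nonneg θ₀) hg
  have hQp : IsProbabilityMeasure (law (θ₀.unlDensity h)) :=
    isProbabilityMeasure_law (hh.unlDensity_nonneg h₀.toIsBounded hπ) (hh.integral_unlDensity hg)
  have hmem : ∀ {θ : Param p}, θ.IsRegular πlow M q → ∀ {x : Fin p → ℝ},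
      x ∈ Set.Icc (0 : Fin p → ℝ) 1 → θ.unlOdds x ∈ Set.Icc (Real.exp (-B)) (Real.exp B) :=
    fun hθ _ hx => hθ.unlOdds_mem hπ hx
  have hae : ∀ᵐ x ∂cubeMeasure p, x ∈ Set.Icc (0 : Fin p → ℝ) 1 := ae_mem_cube p
  have hgm := hh.measurable_posDensity h₀
  have hl : ∀ {θ : Param p}, θ.IsRegular πlow M q →
      Integrable (fun x => θ₀.posDensity h x * labTerm ρ (θ.unlOdds x)) (cubeMeasure p) := by
    intro θ hθ
    refine (integrable_labTerm hρ hB0 hθ.measurable_unlOdds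
      (hae.mono fun x hx => hmem hθ hx)).bdd_mul (c := Real.exp B * C₀)
      hgm.aestronglyMeasurable ?_
    filter_upwards [hae] with x hx
    rw [Real.norm_of_nonneg (hh.posDensity_nonneg θ₀ x)]
    exact (hh.posDensity_mem h₀.toIsBounded hx).2
  have hu : ∀ {θ : Param p}, θ.IsRegular πlow M q →
      Integrable (fun x => θ₀.unlDensity h x * unlTerm ρ (θ.unlOdds x)) (cubeMeasure p) := by
    intro θ hθ
    refine (integrable_unlTerm hρ hB0 hθ.measurable_unlOdds
      (hae.mono fun x hx => hmem hθ hx)).bdd_mul (c := Real.exp B * C₀ * Real.exp B)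
      (hh.measurable_unlDensity h₀).aestronglyMeasurable ?_
    filter_upwards [hae] with x hx
    rw [Real.norm_of_nonneg (hh.unlDensity_nonneg h₀.toIsBounded hπ x), Param.unlDensity_eq]
    exact mul_le_mul (hh.posDensity_mem h₀.toIsBounded hx).2 (hmem h₀ hx).2
      ((Real.exp_pos _).le.trans (hmem h₀ hx).1) (by positivity)
  have hsum : ∀ {θ : Param p}, θ.IsRegular πlow M q → risk ρ (law (θ₀.posDensity h))
      (law (θ₀.unlDensity h)) θ.unlOdds = ∫ x, (ρ * (θ₀.posDensity h x * labTerm ρ (θ.unlOdds x)) +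
        θ₀.unlDensity h x * unlTerm ρ (θ.unlOdds x)) ∂cubeMeasure p := by
    intro θ hθ
    rw [risk, integral_law hgm (hh.posDensity_nonneg θ₀) (hh.posDensity_eq_zero θ₀),
      integral_law (hh.measurable_unlDensity h₀) (hh.unlDensity_nonneg h₀.toIsBounded hπ)
        (hh.unlDensity_eq_zero θ₀), ← integral_const_mul,
      ← integral_add ((hl hθ).const_mul ρ) (hu hθ)]
  have hint : ∀ {θ : Param p}, θ.IsRegular πlow M q → Integrable (fun x =>
      ρ * (θ₀.posDensity h x * labTerm ρ (θ.unlOdds x)) +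
        θ₀.unlDensity h x * unlTerm ρ (θ.unlOdds x)) (cubeMeasure p) := fun hθ =>
    ((hl hθ).const_mul ρ).add (hu hθ)
  rw [hsum h₀, hsum hθ, ← integral_sub (hint h₀) (hint hθ), ← integral_const_mul]
  refine integral_mono_ae ?_ ((hint h₀).sub (hint hθ)) ?_
  · exact (integrable_sq_unlOdds_sub hπ h₀ hθ).const_mul _
  · filter_upwards [hae] with x hx
    have h1 := sq_sub_le_term_gap hρ (hmem h₀ hx) (hmem hθ hx)
    have h2 := (hh.posDensity_mem h₀.toIsBounded hx).1
    have h3 := hh.posDensity_nonneg θ₀ x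
    have h4 : 0 ≤ ρ ^ 2 / (4 * (ρ + Real.exp B) ^ 3) * (θ₀.unlOdds x - θ.unlOdds x) ^ 2 := by
      positivity
    calc Real.exp (-B) * C₀⁻¹ * (ρ ^ 2 / (4 * (ρ + Real.exp B) ^ 3)) *
          (θ.unlOdds x - θ₀.unlOdds x) ^ 2
        = Real.exp (-B) * C₀⁻¹ *
          (ρ ^ 2 / (4 * (ρ + Real.exp B) ^ 3) * (θ₀.unlOdds x - θ.unlOdds x) ^ 2) := by ring
      _ ≤ θ₀.posDensity h x * (ρ ^ 2 / (4 * (ρ + Real.exp B) ^ 3) *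
          (θ₀.unlOdds x - θ.unlOdds x) ^ 2) := mul_le_mul_of_nonneg_right h2 h4
      _ ≤ θ₀.posDensity h x * (ρ * (labTerm ρ (θ₀.unlOdds x) - labTerm ρ (θ.unlOdds x)) +
          θ₀.unlOdds x * (unlTerm ρ (θ₀.unlOdds x) - unlTerm ρ (θ.unlOdds x))) :=
        mul_le_mul_of_nonneg_left h1 h3
      _ = _ := by
        simp only [Param.unlDensity_eq]
        ring

theorem sq_integral_abs_le {E : Type*} [MeasurableSpace E] {P : Measure E}
    [IsProbabilityMeasure P] {f : E → ℝ} (hf : Integrable f P)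
    (hf2 : Integrable (fun x => f x ^ 2) P) : (∫ x, |f x| ∂P) ^ 2 ≤ ∫ x, f x ^ 2 ∂P := by
  set D := ∫ x, |f x| ∂P with hD
  have h1 : Integrable (fun x => 2 * D * |f x| - D ^ 2) P :=
    (hf.abs.const_mul (2 * D)).sub (integrable_const _)
  have h2 : ∫ x, (2 * D * |f x| - D ^ 2) ∂P = D ^ 2 := by
    rw [integral_sub (hf.abs.const_mul _) (integrable_const _), integral_const_mul, ← hD]
    simp
    ring
  rw [← h2]
  refine integral_mono h1 hf2 fun x => ?_
  dsimp only
  nlinarith [sq_nonneg (|f x| - D), sq_abs (f x)]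

theorem IsCubeDensity.pooledLaw_le (hh : IsCubeDensity C₀ h) (hρ : 0 < ρ) (hπ : 0 < πlow)
    (h₀ : θ₀.IsBounded πlow M q) : θ₀.pooledLaw h ρ ≤
      ENNReal.ofReal (Real.exp (predBound M q) * C₀ * Real.exp (predBound M q)) •
        cubeMeasure p := by
  rw [Param.pooledLaw, law_eq_withDensity_cube (fun x hx => by
    rw [hh.posDensity_eq_zero θ₀ x hx, hh.unlDensity_eq_zero θ₀ x hx, mul_zero, mul_zero,
      add_zero]), ← withDensity_const]
  refine withDensity_mono ?_
  filter_upwards [ae_mem_cube p] with x hx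
  refine ENNReal.ofReal_le_ofReal ?_
  have h1 := (hh.posDensity_mem h₀ hx).2
  have h2 := (h₀.unlOdds_mem hπ hx).2
  have h3 := hh.posDensity_nonneg θ₀ x
  have hB := Real.one_le_exp h₀.predBound_nonneg
  have hC₀ := hh.const_pos
  have h4 : θ₀.posDensity h x
      ≤ Real.exp (predBound M q) * C₀ * Real.exp (predBound M q) :=
    h1.trans (le_mul_of_one_le_right (by positivity) hB)
  have h5 : θ₀.unlDensity h x ≤ Real.exp (predBound M q) * C₀ * Real.exp (predBound M q) := by
    rw [Param.unlDensity_eq]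
    exact (mul_le_mul_of_nonneg_left h2 h3).trans
      (mul_le_mul_of_nonneg_right h1 (Real.exp_pos _).le)
  have h6 : ρ / (1 + ρ) + 1 / (1 + ρ) = 1 := by field_simp; ring
  calc _ ≤ ρ / (1 + ρ) * (Real.exp (predBound M q) * C₀ * Real.exp (predBound M q)) +
        1 / (1 + ρ) * (Real.exp (predBound M q) * C₀ * Real.exp (predBound M q)) := by
        gcongr
    _ = _ := by rw [← add_mul, h6, one_mul]

/-- The `L₂(ℙ)` error of a parameter that is uniformly close to a regular parameter. No
measurability of the former is needed. -/
theorem eLpNorm_eta_sub_le (hh : IsCubeDensity C₀ h) (hρ : 0 < ρ) (hπ : 0 < πlow)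
    (h₀ : θ₀.IsRegular πlow M q) {θ' : Param p} (hθ' : θ'.IsRegular πlow M q) {δ : ℝ}
    (hδ : θ.Close δ θ') : eLpNorm (fun x => θ.eta x - θ₀.eta x) 2 (θ₀.pooledLaw h ρ) ≤
      ENNReal.ofReal (Real.exp (predBound M q) * C₀ * Real.exp (predBound M q)) ^ (1 / 2 : ℝ) *
        ENNReal.ofReal (Real.sqrt (∫ x, (θ'.eta x - θ₀.eta x) ^ 2 ∂cubeMeasure p) + δ) := by
  have hδ0 : 0 ≤ δ := (abs_nonneg _).trans hδ.prop
  refine (eLpNorm_mono_measure _ (hh.pooledLaw_le hρ hπ h₀.toIsBounded)).trans ?_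
  rw [eLpNorm_smul_measure_of_ne_top (by simp), smul_eq_mul]
  have e2 : (1 / 2 : ℝ≥0∞).toReal = 1 / 2 := by simp
  rw [e2]
  refine mul_le_mul_right ?_ _
  have hm : Measurable fun x => θ'.eta x - θ₀.eta x := hθ'.measurable_eta.sub h₀.measurable_eta
  have hLp : MemLp (fun x => θ'.eta x - θ₀.eta x) 2 (cubeMeasure p) := by
    refine MemLp.of_bound hm.aestronglyMeasurable (∑ j, q j + ∑ j, q j) ?_
    filter_upwards [ae_mem_cube p] with x hx
    exact (abs_sub _ _).trans (add_le_add (hθ'.abs_eta_le hx) (h₀.abs_eta_le hx))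
  have h1 : eLpNorm (fun x => θ.eta x - θ₀.eta x) 2 (cubeMeasure p)
      ≤ eLpNorm ((fun x => |θ'.eta x - θ₀.eta x|) + fun _ => δ) 2 (cubeMeasure p) := by
    refine eLpNorm_mono_ae_real ?_
    filter_upwards [ae_mem_cube p] with x hx
    have := abs_add_le (θ.eta x - θ'.eta x) (θ'.eta x - θ₀.eta x)
    rw [sub_add_sub_cancel] at this
    rw [Real.norm_eq_abs, Pi.add_apply]
    linarith [hδ.eta x hx]
  refine h1.trans ((eLpNorm_add_le hm.abs.aestronglyMeasurable
    aestronglyMeasurable_const (by norm_num)).trans ?_)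
  rw [ENNReal.ofReal_add (Real.sqrt_nonneg _) hδ0]
  refine add_le_add (le_of_eq ?_) (le_of_eq ?_)
  · have := hLp.norm.eLpNorm_eq_integral_rpow_norm (by norm_num) (by norm_num)
    simp only [Real.norm_eq_abs, abs_abs, ENNReal.toReal_ofNat, Real.rpow_two, sq_abs] at this
    rw [this, Real.sqrt_eq_rpow]
    norm_num
  · rw [eLpNorm_const _ (by norm_num) (IsProbabilityMeasure.ne_zero _)]
    simp [Real.enorm_of_nonneg hδ0]

end Laws

/-! ### Consistency -/

section Consistency

variable {p : ℕ} {πlow M C₀ ρ : ℝ} {q : Fin p → ℝ} {θ₀ : Param p} {h : (Fin p → ℝ) → ℝ}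

/-- The modulus of continuity of the criterion, per unlabeled observation, with respect to the
uniform distance `δ` of the parameters. -/
def critModulus (ρ B δ : ℝ) : ℝ := (1 + ρ) * (2 * Real.exp B * (3 * Real.exp B * δ))

/-- The deterministic part of the consistency proof: if the empirical criterion deviates from the
population criterion by at most `ε` on a net of the sieve, then the estimate is close to a
parameter of the net with almost maximal population criterion. -/
theorem exists_close_risk_le (hρ : 0 < ρ) (hπ : 0 < πlow) (hh : IsCubeDensity C₀ h)
    (hg : ∫ x, θ₀.posDensity h x = 1) (h₀ : θ₀.IsRegular πlow M q) {m K n₀ n₁ : ℕ} (hm : 1 ≤ m)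
    {ξ : Knots K} (hn₁ : 0 < n₁) (hn : (n₀ : ℝ) = ρ * n₁) {x : Fin (n₀ + n₁) → Fin p → ℝ}
    (hx : ∀ i, x i ∈ Set.Icc (0 : Fin p → ℝ) 1) {T : Finset (Param p)} {δ ε : ℝ}
    (hT : ∀ θ ∈ T, θ.IsRegular πlow M q)
    (hnet : ∀ θ ∈ sieve m ξ πlow M q, ∃ θ' ∈ T, θ.Close δ θ')
    (hdev : ∀ θ ∈ T, |empSum ρ x θ.unlOdds - n₁ * risk ρ (law (θ₀.posDensity h))
      (law (θ₀.unlDensity h)) θ.unlOdds| ≤ n₁ * ε)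
    {θs θe : Param p} (hθs : θs ∈ sieve m ξ πlow M q) (hθs₀ : θs.Close δ θ₀)
    (hθe : IsSieveEstimate m ξ πlow M q x θe) :
    ∃ θ' ∈ T, θe.Close δ θ' ∧
      risk ρ (law (θ₀.posDensity h)) (law (θ₀.unlDensity h)) θ₀.unlOdds -
        risk ρ (law (θ₀.posDensity h)) (law (θ₀.unlDensity h)) θ'.unlOdds
        ≤ 2 * ε + 4 * critModulus ρ (predBound M q) δ := by
  have hn₁' : (0 : ℝ) < n₁ := by exact_mod_cast hn₁
  have hPp : IsProbabilityMeasure (law (θ₀.posDensity h)) :=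
    isProbabilityMeasure_law (hh.posDensity_nonneg θ₀) hg
  have hQp : IsProbabilityMeasure (law (θ₀.unlDensity h)) :=
    isProbabilityMeasure_law (hh.unlDensity_nonneg h₀.toIsBounded hπ) (hh.integral_unlDensity hg)
  have hPc := ae_law_mem_cube (hh.posDensity_eq_zero θ₀)
  have hQc := ae_law_mem_cube (hh.unlDensity_eq_zero θ₀)
  obtain ⟨θe', hTe, hce⟩ := hnet θe hθe.1
  obtain ⟨θs', hTs, hcs⟩ := hnet θs hθs
  have hbe := isBounded_of_mem_sieve hm hθe.1
  have hbs := isBounded_of_mem_sieve hm hθs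
  -- the empirical criterion at the estimate and at the spline approximation of the truth
  have hemp : ∀ {θ θ' : Param p}, θ.IsBounded πlow M q → θ'.IsBounded πlow M q → θ.Close δ θ' →
      |empSum ρ x θ.unlOdds - empSum ρ x θ'.unlOdds|
        ≤ n₁ * critModulus ρ (predBound M q) δ := fun hθ hθ' hc =>
    abs_empSum_sub_le hρ hn (fun i => (hθ.unlOdds_mem hπ (hx i)).1)
      (fun i => (hθ'.unlOdds_mem hπ (hx i)).1)
      (fun i => hc.abs_unlOdds_sub_le hθ hθ' hπ (hx i))
  have hmax : empSum ρ x θs.unlOdds ≤ empSum ρ x θe.unlOdds := by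
    have := hθe.2 hθs
    simp only [Set.mem_ofPred_eq] at this
    rw [profileLogLik_eq hρ hn₁ hn x (hbs.prop_pos hπ) (hbs.prop_lt_one hπ),
      profileLogLik_eq hρ hn₁ hn x (hbe.prop_pos hπ) (hbe.prop_lt_one hπ)] at this
    exact le_of_add_le_add_left this
  have hrisk : |risk ρ (law (θ₀.posDensity h)) (law (θ₀.unlDensity h)) θs'.unlOdds -
      risk ρ (law (θ₀.posDensity h)) (law (θ₀.unlDensity h)) θ₀.unlOdds|
      ≤ 2 * critModulus ρ (predBound M q) δ := by
    have hs' := hT θs' hTs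
    have hd : ∀ y ∈ Set.Icc (0 : Fin p → ℝ) 1, |θs'.unlOdds y - θ₀.unlOdds y|
        ≤ 2 * (3 * Real.exp (predBound M q) * δ) := by
      intro y hy
      have h1 := hcs.symm.abs_unlOdds_sub_le hs'.toIsBounded hbs hπ hy
      have h2 := hθs₀.abs_unlOdds_sub_le hbs h₀.toIsBounded hπ hy
      have h3 := abs_add_le (θs'.unlOdds y - θs.unlOdds y) (θs.unlOdds y - θ₀.unlOdds y)
      rw [sub_add_sub_cancel] at h3
      linarith
    have := abs_risk_sub_le (P := law (θ₀.posDensity h)) (Q := law (θ₀.unlDensity h)) hρ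
      h₀.predBound_nonneg hs'.measurable_unlOdds h₀.measurable_unlOdds
      (hPc.mono fun _ hy => hs'.unlOdds_mem hπ hy) (hPc.mono fun _ hy => h₀.unlOdds_mem hπ hy)
      (hQc.mono fun _ hy => hs'.unlOdds_mem hπ hy) (hQc.mono fun _ hy => h₀.unlOdds_mem hπ hy)
      (hPc.mono hd) (hQc.mono hd)
    refine this.trans (le_of_eq ?_)
    unfold critModulus
    ring
  refine ⟨θe', hTe, hce, ?_⟩
  have d1 := (abs_le.1 (hdev θe' hTe)).2
  have d2 := (abs_le.1 (hdev θs' hTs)).1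
  have d3 := (abs_le.1 (hemp hbe (hT θe' hTe).toIsBounded hce)).2
  have d4 := (abs_le.1 (hemp hbs (hT θs' hTs).toIsBounded hcs)).1
  have d5 := (abs_le.1 hrisk).1
  have d6 : (n₁ : ℝ) * (risk ρ (law (θ₀.posDensity h)) (law (θ₀.unlDensity h)) θs'.unlOdds -
      risk ρ (law (θ₀.posDensity h)) (law (θ₀.unlDensity h)) θe'.unlOdds)
      ≤ n₁ * (2 * ε + 2 * critModulus ρ (predBound M q) δ) := by
    linarith
  have d7 := le_of_mul_le_mul_left d6 hn₁'
  linarith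

/-- With probability tending to one, the estimate is uniformly close to a regular parameter whose
odds are `L₁`-close to the true odds. -/
theorem tendsto_measure_not_close {Ω : Type*} [MeasurableSpace Ω] (μ : Measure Ω)
    [IsProbabilityMeasure μ] (hρ : 0 < ρ) (hπ : 0 < πlow) (hh : IsCubeDensity C₀ h)
    (hg : ∫ x, θ₀.posDensity h x = 1) (h₀ : θ₀.IsRegular πlow M q)
    (hc : ∀ j, ContinuousOn (θ₀.comp j) (Set.Icc 0 1)) {m : ℕ} (hm : 1 ≤ m) (n₀ n₁ : ℕ → ℕ)
    (hn_ratio : ∀ t, (n₀ t : ℝ) = ρ * n₁ t) (hn : Tendsto (fun t => n₀ t + n₁ t) atTop atTop)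
    (K : ℕ → ℕ) (ξ : ∀ t, Knots (K t))
    (hK : (fun t => (K t : ℝ)) =o[atTop] fun t => ((n₀ t + n₁ t : ℕ) : ℝ))
    (h_mesh : Tendsto (fun t => (ξ t).mesh) atTop (𝓝 0))
    (X : ∀ t, Fin (n₀ t + n₁ t) → Ω → Fin p → ℝ) (hX : ∀ t, IsPUSample μ θ₀ h (X t))
    (est : ℕ → Ω → Param p)
    (h_est : ∀ t, ∀ᵐ ω ∂μ, IsSieveEstimate m (ξ t) πlow M q (fun i => X t i ω) (est t ω))
    {r : ℝ} (hr : 0 < r) :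
    Tendsto (fun t => μ {ω | ¬ ∃ θ' : Param p, θ'.IsRegular πlow M q ∧ (est t ω).Close r θ' ∧
      ∫ x, |θ'.unlOdds x - θ₀.unlOdds x| ∂cubeMeasure p ≤ r}) atTop (𝓝 0) := by
  set B := predBound M q with hB
  have hB0 : 0 ≤ B := h₀.predBound_nonneg
  have hC₀ := hh.const_pos
  set c := Real.exp (-B) * C₀⁻¹ * (ρ ^ 2 / (4 * (ρ + Real.exp B) ^ 3)) with hcdef
  have hc0 : 0 < c := by positivity
  set L := (1 + ρ) * (2 * Real.exp B * (3 * Real.exp B)) with hL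
  have hL0 : 0 < L := by positivity
  -- these tolerances make the total loss `2 * ε + 4 * L * δ` at most `c * r ^ 2`
  set ε := c * r ^ 2 / 4 with hε
  have hε0 : 0 < ε := by positivity
  set δ := min r (c * r ^ 2 / (8 * L)) with hδ
  have hδ0 : 0 < δ := lt_min hr (by positivity)
  have hmod : 2 * ε + 4 * critModulus ρ B δ ≤ c * r ^ 2 := by
    have h1 : δ ≤ c * r ^ 2 / (8 * L) := min_le_right _ _
    rw [le_div_iff₀ (by positivity)] at h1
    have h2 : critModulus ρ B δ = L * δ := by
      rw [critModulus, hL]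
      ring
    rw [h2, hε]
    linarith
  obtain ⟨A, hA, hnet⟩ := exists_sieve_net hm πlow M hπ.le q hδ0
  choose T hcard hTreg hTnet using fun t => hnet (K t) (ξ t)
  obtain ⟨r₀, hr₀, happrox⟩ := exists_mem_sieve_close hm h₀ hc hδ0
  have hPc := ae_law_mem_cube (hh.posDensity_eq_zero θ₀)
  have hQc := ae_law_mem_cube (hh.unlDensity_eq_zero θ₀)
  set κ := ε ^ 2 / (2 * ((1 + ρ) * termBound ρ B) ^ 2) with hκ
  have hκ0 : 0 < κ := by
    have := termBound_pos hρ hB0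
    positivity
  have hlim := ENNReal.tendsto_ofReal (tendsto_card_mul_exp hn hK hκ0 A p m hA)
  rw [ENNReal.ofReal_zero] at hlim
  refine tendsto_of_tendsto_of_tendsto_of_le_of_le' tendsto_const_nhds hlim
    (Eventually.of_forall fun _ => zero_le) ?_
  filter_upwards [h_mesh.eventually_lt_const hr₀, hn.eventually_ge_atTop 1] with t hmesh hnt
  have hn₁ : 0 < n₁ t := by
    rcases Nat.eq_zero_or_pos (n₁ t) with h0 | h0
    · have := hn_ratio t
      rw [h0, Nat.cast_zero, mul_zero, Nat.cast_eq_zero] at this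
      omega
    · exact h0
  obtain ⟨θs, hθs, hθs₀⟩ := happrox (K t) (ξ t) hmesh
  have hXcube : ∀ᵐ ω ∂μ, ∀ i, X t i ω ∈ Set.Icc (0 : Fin p → ℝ) 1 := by
    have hmeas : Measurable fun x : Fin p → ℝ => x ∈ Set.Icc (0 : Fin p → ℝ) 1 :=
      measurableSet_setOfPred.1 measurableSet_Icc
    rw [ae_all_iff]
    intro i
    induction i using Fin.addCases with
    | left i => exact (((hX t).2.1 i).ae_iff hmeas).2 hPc
    | right i => exact (((hX t).2.2 i).ae_iff hmeas).2 hQc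
  refine (measure_mono_ae ?_).trans ((measure_exists_deviation_le (ε := ε) hρ hB0 hε0.le hn₁
    (hn_ratio t) (hX t).1 (hX t).2.1 (hX t).2.2 (T t) Param.unlOdds
    (fun θ hθ => (hTreg t θ hθ).measurable_unlOdds)
    (fun θ hθ => hPc.mono fun x hx => (hTreg t θ hθ).unlOdds_mem hπ hx)
    (fun θ hθ => hQc.mono fun x hx => (hTreg t θ hθ).unlOdds_mem hπ hx)).trans ?_)
  · filter_upwards [hXcube, h_est t] with ω hω hest hbad
    by_contra hgood
    refine hbad ?_
    have hdev : ∀ θ ∈ T t, |empSum ρ (fun i => X t i ω) θ.unlOdds - n₁ t *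
        risk ρ (law (θ₀.posDensity h)) (law (θ₀.unlDensity h)) θ.unlOdds| ≤ n₁ t * ε := by
      intro θ hθ
      by_contra hlt
      exact hgood ⟨θ, hθ, (not_le.1 hlt).le⟩
    obtain ⟨θ', hθ', hclose, hgap⟩ := exists_close_risk_le hρ hπ hh hg h₀ hm hn₁ (hn_ratio t)
      hω (hTreg t) (hTnet t) hdev hθs hθs₀ hest
    have hreg := hTreg t θ' hθ'
    refine ⟨θ', hreg, ⟨hclose.prop.trans (min_le_left _ _), hclose.alpha.trans (min_le_left _ _),
      fun x hx => (hclose.eta x hx).trans (min_le_left _ _)⟩, ?_⟩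
    have hsq := sq_dist_le_risk_gap hρ hπ hh hg h₀ hreg
    have hV : Integrable (fun x => θ'.unlOdds x - θ₀.unlOdds x) (cubeMeasure p) :=
      (hreg.integrable_unlOdds hπ).sub (h₀.integrable_unlOdds hπ)
    have hJ := sq_integral_abs_le hV (integrable_sq_unlOdds_sub hπ h₀ hreg)
    have h1 : c * (∫ x, |θ'.unlOdds x - θ₀.unlOdds x| ∂cubeMeasure p) ^ 2 ≤ c * r ^ 2 :=
      (mul_le_mul_of_nonneg_left hJ hc0.le).trans (hsq.trans (hgap.trans hmod))
    exact le_of_sq_le_sq (le_of_mul_le_mul_left h1 hc0) hr.le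
  · refine ENNReal.ofReal_le_ofReal ?_
    gcongr
    exact_mod_cast hcard t

end Consistency

end GAET

end

theorem theorem2 {Ω : Type*} [MeasurableSpace Ω] (μ : Measure Ω) [IsProbabilityMeasure μ]
    -- the true parameter `(π₀, α₀, u_1, …, u_p)` and the negative class density `h`
    (p : ℕ) (θ₀ : GAET.Param p) (h : (Fin p → ℝ) → ℝ)
    -- `h` and `g` are probability densities
    (h_meas : Measurable h) (h_int : ∫ x, h x = 1) (g_int : ∫ x, θ₀.posDensity h x = 1)
    -- known bounds for the scalar parameters
    (M πlow : ℝ) (hπlow : πlow ∈ Set.Ioo (0 : ℝ) (1 / 2))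
    (hα₀ : |θ₀.alpha| ≤ M) (hπ₀ : θ₀.prop ∈ Set.Icc πlow (1 - πlow))
    -- the support is the unit cube and `h` is bounded above and below on it
    (h_supp : ∀ x, x ∉ Set.Icc (0 : Fin p → ℝ) 1 → h x = 0)
    (C₀ : ℝ) (hC₀ : 0 < C₀)
    (h_bdd : ∀ x ∈ Set.Icc (0 : Fin p → ℝ) 1, C₀⁻¹ ≤ h x ∧ h x ≤ C₀)
    -- smooth centered additive components
    (m k : ℕ) (hm : 2 ≤ m) (hk : 0 < k) (hkm : k ≤ m)
    (hu_smooth : ∀ j, ContDiffOn ℝ k (θ₀.comp j) (Set.Icc 0 1))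
    (hu_center : ∀ j, ∫ x in (0 : ℝ)..1, θ₀.comp j x = 0)
    -- identifiability of the model: two distinct components are not constant
    (hu_ident : ∃ j l, j ≠ l ∧ (¬ ∃ c, ∀ x ∈ Set.Icc (0 : ℝ) 1, θ₀.comp j x = c) ∧
      ¬ ∃ c, ∀ x ∈ Set.Icc (0 : ℝ) 1, θ₀.comp l x = c)
    -- the coefficient bounds of the sieve are compatible with the true components
    (q : Fin p → ℝ) (hq : ∀ j, ∀ x ∈ Set.Icc (0 : ℝ) 1, |θ₀.comp j x| ≤ q j)
    -- the sample sizes, with constant ratio `ρ`, tend to infinity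
    (n₀ n₁ : ℕ → ℕ) (ρ : ℝ) (hρ : 0 < ρ) (hn_ratio : ∀ t, (n₀ t : ℝ) = ρ * n₁ t)
    (hn : Tendsto (fun t => n₀ t + n₁ t) atTop atTop)
    -- the knots
    (K : ℕ → ℕ) (ξ : ∀ t, GAET.Knots (K t))
    (hK : Tendsto K atTop atTop)
    (hK_rate : (fun t => (K t : ℝ) ^ (1 / 2 : ℝ) * Real.log (K t)) =o[atTop]
      fun t => Real.sqrt ((n₀ t + n₁ t : ℕ) : ℝ))
    (h_mesh : Tendsto (fun t => (ξ t).mesh) atTop (𝓝 0))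
    -- the data and the estimators
    (X : ∀ t, Fin (n₀ t + n₁ t) → Ω → Fin p → ℝ)
    (hX : ∀ t, GAET.IsPUSample μ θ₀ h (X t))
    (est : ℕ → Ω → GAET.Param p)
    (h_est : ∀ t, ∀ᵐ ω ∂μ,
      GAET.IsSieveEstimate m (ξ t) πlow M q (fun i => X t i ω) (est t ω)) :
    TendstoInMeasure μ (fun t ω => (est t ω).alpha) atTop (fun _ => θ₀.alpha) ∧
    TendstoInMeasure μ (fun t ω => (est t ω).prop) atTop (fun _ => θ₀.prop) ∧
    ∀ ε : ℝ≥0∞, 0 < ε →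
      Tendsto (fun t => μ {ω | ε ≤
        eLpNorm (fun x => (est t ω).eta x - θ₀.eta x) 2 (θ₀.pooledLaw h ρ)}) atTop (𝓝 0) := by
  have hπ : 0 < πlow := hπlow.1
  have hh : GAET.IsCubeDensity C₀ h := ⟨h_meas, h_int, h_supp, hC₀, h_bdd⟩
  have hmono : ∀ s : ℕ → Set Ω, ∀ s' : ℕ → Set Ω, (∀ t, s t ⊆ s' t) →
      Tendsto (fun t => μ (s' t)) atTop (𝓝 0) → Tendsto (fun t => μ (s t)) atTop (𝓝 0) :=
    fun s s' hs hs' => tendsto_of_tendsto_of_tendsto_of_le_of_le tendsto_const_nhds hs'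
      (fun _ => zero_le) fun t => measure_mono (hs t)
  -- the components are only controlled on `[0,1]`; extend them constantly beyond the end points
  obtain ⟨θ, hθp, hθa, hθc⟩ : ∃ θ : GAET.Param p, θ.prop = θ₀.prop ∧ θ.alpha = θ₀.alpha ∧
      ∀ j, θ.comp j = fun x => θ₀.comp j (max 0 (min 1 x)) :=
    ⟨⟨θ₀.prop, θ₀.alpha, fun j x => θ₀.comp j (max 0 (min 1 x))⟩, rfl, rfl, fun _ => rfl⟩
  have hcomp : ∀ j, ∀ x ∈ Set.Icc (0 : ℝ) 1, θ.comp j x = θ₀.comp j x := fun j x hx => by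
    simp only [hθc, min_eq_right hx.2, max_eq_right hx.1]
  have heta : ∀ x ∈ Set.Icc (0 : Fin p → ℝ) 1, θ.eta x = θ₀.eta x := fun x hx =>
    Finset.sum_congr rfl fun j _ => hcomp j _ (GAET.apply_mem_Icc hx j)
  have hcont : ∀ j, Continuous (θ.comp j) := fun j => by
    rw [hθc]
    exact (hu_smooth j).continuousOn.comp_continuous (by fun_prop)
      fun x => ⟨le_max_left _ _, max_le zero_le_one (min_le_left _ _)⟩
  have hreg : θ.IsRegular πlow M q :=
    { prop_mem := hθp ▸ hπ₀
      abs_alpha_le := hθa ▸ hα₀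
      abs_comp_le := fun j x hx => by rw [hcomp j x hx]; exact hq j x hx
      measurable_comp := fun j => (hcont j).measurable
      integral_comp := fun j => by
        refine (intervalIntegral.integral_congr fun x hx => ?_).trans (hu_center j)
        rw [Set.uIcc_of_le zero_le_one] at hx
        exact hcomp j x hx }
  have hpos : θ.posDensity h = θ₀.posDensity h := by
    ext x
    by_cases hx : x ∈ Set.Icc (0 : Fin p → ℝ) 1
    · rw [GAET.Param.posDensity, GAET.Param.posDensity, hθa, heta x hx]
    · rw [hh.posDensity_eq_zero θ x hx, hh.posDensity_eq_zero θ₀ x hx]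
  have hunl : θ.unlDensity h = θ₀.unlDensity h := by
    ext x
    rw [GAET.Param.unlDensity, GAET.Param.unlDensity, hθp, hpos]
  have hpool : θ.pooledLaw h ρ = θ₀.pooledLaw h ρ := by
    rw [GAET.Param.pooledLaw, GAET.Param.pooledLaw, hpos, hunl]
  have hident : ∃ j l, j ≠ l ∧ (¬ ∃ c, ∀ x ∈ Set.Icc (0 : ℝ) 1, θ.comp j x = c) ∧
      ¬ ∃ c, ∀ x ∈ Set.Icc (0 : ℝ) 1, θ.comp l x = c := by
    obtain ⟨j, l, hjl, hj, hl⟩ := hu_ident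
    exact ⟨j, l, hjl, fun ⟨c, hc⟩ => hj ⟨c, fun x hx => hcomp j x hx ▸ hc x hx⟩,
      fun ⟨c, hc⟩ => hl ⟨c, fun x hx => hcomp l x hx ▸ hc x hx⟩⟩
  have hX' : ∀ t, GAET.IsPUSample μ θ h (X t) := fun t => by
    rw [GAET.IsPUSample, hpos, hunl]
    exact hX t
  have hcore : ∀ r : ℝ, 0 < r → _ := fun r hr =>
    GAET.tendsto_measure_not_close μ hρ hπ hh (hpos ▸ g_int) hreg
      (fun j => (hcont j).continuousOn) (by omega) n₀ n₁ hn_ratio hn K ξ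
      (GAET.isLittleO_knots hK hK_rate) h_mesh X hX' est h_est hr
  obtain ⟨C, hC, hid⟩ := GAET.exists_identification hπ hreg
    (fun j => (hcont j).continuousOn) hident
  refine ⟨?_, ?_, ?_⟩
  · rw [tendstoInMeasure_iff_dist]
    intro ε hε
    refine hmono _ _ (fun t ω hω => ?_) (hcore (ε / (2 * (1 + C))) (by positivity))
    rintro ⟨θ', hθ', hclose, hD⟩
    have h1 := (hid θ' hθ').2.1.trans (mul_le_mul_of_nonneg_left hD hC)
    have h2 := dist_triangle (est t ω).alpha θ'.alpha θ₀.alpha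
    have h3 := hclose.alpha
    have h4 : ε / (2 * (1 + C)) + C * (ε / (2 * (1 + C))) = ε / 2 := by field_simp
    simp only [Set.mem_ofPred_eq] at hω
    rw [Real.dist_eq (est t ω).alpha θ'.alpha, Real.dist_eq θ'.alpha, ← hθa] at h2
    rw [← hθa] at hω
    linarith
  · rw [tendstoInMeasure_iff_dist]
    intro ε hε
    refine hmono _ _ (fun t ω hω => ?_) (hcore (ε / (2 * (1 + C))) (by positivity))
    rintro ⟨θ', hθ', hclose, hD⟩
    have h1 := (hid θ' hθ').1.trans (mul_le_mul_of_nonneg_left hD hC)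
    have h2 := dist_triangle (est t ω).prop θ'.prop θ₀.prop
    have h3 := hclose.prop
    have h4 : ε / (2 * (1 + C)) + C * (ε / (2 * (1 + C))) = ε / 2 := by field_simp
    simp only [Set.mem_ofPred_eq] at hω
    rw [Real.dist_eq (est t ω).prop θ'.prop, Real.dist_eq θ'.prop, ← hθp] at h2
    rw [← hθp] at hω
    linarith
  · intro ε hε
    set c : ℝ≥0∞ := ENNReal.ofReal
      (Real.exp (GAET.predBound M q) * C₀ * Real.exp (GAET.predBound M q)) ^ (1 / 2 : ℝ) with hc
    have hc_top : c ≠ ∞ := ENNReal.rpow_ne_top_of_nonneg (by norm_num) ENNReal.ofReal_ne_top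
    -- a tolerance `r` for which the bound on the `L₂` error is below `ε`
    obtain ⟨r, hr, hrε⟩ : ∃ r : ℝ, 0 < r ∧ c * ENNReal.ofReal (Real.sqrt (C * r) + r) < ε := by
      have hlim : Tendsto (fun r : ℝ => c * ENNReal.ofReal (Real.sqrt (C * r) + r)) (𝓝[>] 0)
          (𝓝 (c * ENNReal.ofReal (Real.sqrt (C * 0) + 0))) := by
        refine ENNReal.Tendsto.const_mul (ENNReal.tendsto_ofReal ?_) (Or.inr hc_top)
        have : Continuous fun r : ℝ => Real.sqrt (C * r) + r := by fun_prop
        exact (this.tendsto 0).mono_left nhdsWithin_le_nhds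
      have h0 : c * ENNReal.ofReal (Real.sqrt (C * 0) + 0) < ε := by simpa using hε
      obtain ⟨r, hr1, hr2⟩ := ((hlim.eventually_lt_const h0).and self_mem_nhdsWithin).exists
      exact ⟨r, hr2, hr1⟩
    refine hmono _ _ (fun t ω hω => ?_) (hcore r hr)
    rintro ⟨θ', hθ', hclose, hD⟩
    have h1 := (hid θ' hθ').2.2.trans (mul_le_mul_of_nonneg_left hD hC)
    have h2 := GAET.eLpNorm_eta_sub_le hh hρ hπ hreg hθ' hclose
    have h3 : eLpNorm (fun x => (est t ω).eta x - θ₀.eta x) 2 (θ₀.pooledLaw h ρ)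
        = eLpNorm (fun x => (est t ω).eta x - θ.eta x) 2 (θ.pooledLaw h ρ) := by
      rw [hpool]
      refine eLpNorm_congr_ae ?_
      have hae := GAET.ae_law_mem_cube (f := fun x => ρ / (1 + ρ) * θ₀.posDensity h x +
        1 / (1 + ρ) * θ₀.unlDensity h x) fun x hx => by
          rw [hh.posDensity_eq_zero θ₀ x hx, hh.unlDensity_eq_zero θ₀ x hx, mul_zero, mul_zero,
            add_zero]
      exact hae.mono fun x hx => by simp only [heta x hx]
    simp only [Set.mem_ofPred_eq] at hω
    rw [h3] at hω
    refine (lt_irrefl ε) ((hω.trans h2).trans_lt (lt_of_le_of_lt ?_ hrε))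
    gcongr
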